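/- Let $q>0$ be real. For $k\in\mathbb Z$ put $[k]_q=\frac{q^k-1}{q-1}$ (and $[k]_q=k$ if $q=1$). Let $H_n(q)$ be the unital associative $\mathbb C$-algebra with generators $g_1,\dots,g_{n-1}$ and relations $g_i^2=(q-1)g_i+q$, $g_ig_{i+1}g_i=g_{i+1}g_ig_{i+1}$, and $g_ig_j=g_jg_i$ for $|i-j|\ge 2$. Irreducible representations of $H_n(q)$ are labelled by Young diagrams $\lambda$ with $n$ boxes through Young's seminormal form: the representation labelled by $\lambda$ has a basis $(v_T)$ indexed by the standard tableaux $T$ of shape $\lambda$ on which $g_i v_T=\alpha v_T+(1+\alpha)v_{s_iT}$, where $\alpha=q^{d}/[d]_q$, $d$ is the content (column minus row) of the box of $i+1$ in $T$ minus that of the box of $i$, $s_iT$ is $T$ with $i$ and $i+1$ exchanged, and $v_{s_iT}=0$ if $s_iT$ is not standard. A diagram contains another one if each row of the latter is at most as long as the corresponding row of the former. The Murphy operators are $$L_j^{(i)}=\sum_{k=0}^{j-2}q^{-k}\,g_{j+i-2-k}\cdots g_{j+i-3}\,g_{j+i-2}\,g_{j+i-3}\cdots g_{j+i-2-k}\qquad(i\ge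 1,\ j\ge 2,\ i+j\le n+1).$$ Let $\ell_h,\ell_v\ge 1$, $N=\ell_h\ell_v$, and let $[\ell_h^{\ell_v}]$ be the rectangular Young diagram with $\ell_v$ rows of length $\ell_h$. For $n\ge N$ and $1\le i\le n+1-N$ put $$C^{(i)}_{\ell_h}=\frac{\prod_{j=2}^{N}\bigl(L^{(i)}_j-q[\ell_h]_q\bigr)}{\prod'_{a,b}\bigl(q[a-b]_q-q[\ell_h]_q\bigr)},\qquad R^{(i)}_{\ell_v}=\frac{\prod_{j=2}^{N}\bigl(L^{(i)}_j-q[-\ell_v]_q\bigr)}{\prod'_{a,b}\bigl(q[a-b]_q-q[-\ell_v]_q\bigr)},\qquad Q^{(i)}_{\ell_h,\ell_v}=R^{(i)}_{\ell_v}C^{(i)}_{\ell_h},$$ where $\prod'_{a,b}$ runs over $1\le a\le \ell_h$, $1\le b\le \ell_v$, $(a,b)\ne(1,1)$. Then: 1. On the irreducible representation of $H_N(q)$ labelled by $[\ell_h^{\ell_v}]$ the operator $Q^{(1)}_{\ell_h,\ell_v}$ is the identity, and on every irreducible representation labelled by another diagram it is zero. 2. Let $n\ge N$ and let $V$ be an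 irreducible representation of $H_n(q)$ labelled by $\lambda$. If $\lambda$ does not contain $[\ell_h^{\ell_v}]$, then $Q^{(i)}_{\ell_h,\ell_v}$ acts as zero on $V$ for all $i=1,\dots,n+1-N$; if $\lambda$ contains $[\ell_h^{\ell_v}]$, then already $Q^{(1)}_{\ell_h,\ell_v}$ acts as a nonzero operator on $V$. 3. Let $n\ge N$ and let $B$ be a quotient algebra of $H_n(q)$. The images in $B$ of all $Q^{(i)}_{\ell_h,\ell_v}$, $i=1,\dots,n+1-N$, vanish if and only if no irreducible representation of $B$, regarded as a representation of $H_n(q)$, is labelled by a Young diagram that contains $[\ell_h^{\ell_v}]$. -/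

import Mathlib

noncomputable section

namespace HeckeRect

/-- The `q`-number `[k]_q = (q ^ k - 1) / (q - 1)` of an integer `k`, read as `k` at `q = 1`. -/
def qNum (q : ℂ) (k : ℤ) : ℂ :=
  if q = 1 then (k : ℂ) else (q ^ k - 1) / (q - 1)

/-- The defining relations of the Hecke algebra `H_n(q)`. The index `i : Fin (n - 1)` stands for
the generator usually written `g_{i+1}`. -/
inductive HeckeRel (n : ℕ) (q : ℂ) :
    FreeAlgebra ℂ (Fin (n - 1)) → FreeAlgebra ℂ (Fin (n - 1)) → Prop
  | quad (i : Fin (n - 1)) :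
      HeckeRel n q (FreeAlgebra.ι ℂ i * FreeAlgebra.ι ℂ i)
        ((q - 1) • FreeAlgebra.ι ℂ i + algebraMap ℂ _ q)
  | braid (i j : Fin (n - 1)) (h : (i : ℕ) + 1 = j) :
      HeckeRel n q (FreeAlgebra.ι ℂ i * FreeAlgebra.ι ℂ j * FreeAlgebra.ι ℂ i)
        (FreeAlgebra.ι ℂ j * FreeAlgebra.ι ℂ i * FreeAlgebra.ι ℂ j)
  | comm (i j : Fin (n - 1)) (h : (i : ℕ) + 2 ≤ j) :
      HeckeRel n q (FreeAlgebra.ι ℂ i * FreeAlgebra.ι ℂ j)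
        (FreeAlgebra.ι ℂ j * FreeAlgebra.ι ℂ i)

/-- The Hecke algebra `H_n(q)` over `ℂ`, by generators and relations. -/
abbrev Hecke (n : ℕ) (q : ℂ) : Type := RingQuot (HeckeRel n q)

/-- The generator `g_k` of `H_n(q)` for `1 ≤ k ≤ n - 1` (and `0` for the other, unused, `k`). -/
def gen (n : ℕ) (q : ℂ) (k : ℕ) : Hecke n q :=
  if h : 1 ≤ k ∧ k ≤ n - 1 then
    RingQuot.mkAlgHom ℂ (HeckeRel n q) (FreeAlgebra.ι ℂ ⟨k - 1, by omega⟩)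
  else 0

/-- The palindromic word `g_{m-k} ⋯ g_{m-1} g_m g_{m-1} ⋯ g_{m-k}`. -/
def palindrome (n : ℕ) (q : ℂ) (m : ℕ) : ℕ → Hecke n q
  | 0 => gen n q m
  | k + 1 => gen n q (m - (k + 1)) * palindrome n q m k * gen n q (m - (k + 1))

/-- The Murphy operator `L_j^{(i)}` (`i ≥ 1`, `2 ≤ j`, `i + j ≤ n + 1`) of the subalgebra
generated by `g_i, g_{i+1}, …`:
`L_j^{(i)} = ∑_{k=0}^{j-2} q^{-k} g_{j+i-2-k} ⋯ g_{j+i-2} ⋯ g_{j+i-2-k}`. -/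
def murphy (n : ℕ) (q : ℂ) (i j : ℕ) : Hecke n q :=
  ∑ k ∈ Finset.range (j - 1), (q ^ k)⁻¹ • palindrome n q (j + i - 2) k

/-- `∏_{j=2}^{N} (L_j^{(i)} - c)`, the factors (which commute) taken in the order of `j`. -/
def murphyProd (n : ℕ) (q : ℂ) (i N : ℕ) (c : ℂ) : Hecke n q :=
  ((List.range' 2 (N - 1)).map fun j => murphy n q i j - algebraMap ℂ (Hecke n q) c).prod

/-- `∏' (q[a - b]_q - c)` over the boxes of the rectangle with `lv` rows and `lh` columns
other than the corner box; here `a` is the column and `b` the row of the box. -/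
def rectDenom (q : ℂ) (lh lv : ℕ) (c : ℂ) : ℂ :=
  ∏ p ∈ (Finset.Icc 1 lh ×ˢ Finset.Icc 1 lv).erase (1, 1),
    (q * qNum q ((p.1 : ℤ) - (p.2 : ℤ)) - c)

/-- The operator `C_{lh}^{(i)}`. -/
def opC (n : ℕ) (q : ℂ) (lh lv i : ℕ) : Hecke n q :=
  (rectDenom q lh lv (q * qNum q lh))⁻¹ • murphyProd n q i (lh * lv) (q * qNum q lh)

/-- The operator `R_{lv}^{(i)}`. -/
def opR (n : ℕ) (q : ℂ) (lh lv i : ℕ) : Hecke n q :=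
  (rectDenom q lh lv (q * qNum q (-(lv : ℤ))))⁻¹ •
    murphyProd n q i (lh * lv) (q * qNum q (-(lv : ℤ)))

/-- `Q_{lh,lv}^{(i)} = R_{lv}^{(i)} C_{lh}^{(i)}`. -/
def opQ (n : ℕ) (q : ℂ) (lh lv i : ℕ) : Hecke n q :=
  opR n q lh lv i * opC n q lh lv i

/-- The rectangular Young diagram `[lh ^ lv]`: `lv` rows of length `lh`. -/
def rect (lh lv : ℕ) : YoungDiagram where
  cells := Finset.range lv ×ˢ Finset.range lh
  isLowerSet := by
    rintro ⟨a, b⟩ ⟨c, d⟩ h hab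
    obtain ⟨h1, h2⟩ := Prod.mk_le_mk.mp h
    simp only [Finset.coe_product, Finset.coe_range, Set.mem_prod, Set.mem_Iio] at hab ⊢
    exact ⟨h1.trans_lt hab.1, h2.trans_lt hab.2⟩

/-- A standard Young tableau of shape `μ` with `n` boxes: `box k` is the position (row, column),
counted from `0`, of the entry `k + 1`; entries increase along rows and columns. -/
@[ext]
structure StandardTableau (n : ℕ) (μ : YoungDiagram) where
  box : Fin n → ℕ × ℕ
  injective : Function.Injective box
  range_eq : Set.range box = (μ.cells : Set (ℕ × ℕ))
  standard : ∀ a b, box a ≤ box b → a ≤ b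

namespace StandardTableau

variable {n : ℕ} {μ : YoungDiagram}

/-- The content (column minus row) of the box that holds the entry `k + 1`. -/
def content (T : StandardTableau n μ) (k : Fin n) : ℤ :=
  ((T.box k).2 : ℤ) - ((T.box k).1 : ℤ)

/-- The position in `Fin n` of the smaller entry moved by the generator with index `i`. -/
def lo (i : Fin (n - 1)) : Fin n := ⟨i, by omega⟩

/-- The position in `Fin n` of the larger entry moved by the generator with index `i`. -/
def hi (i : Fin (n - 1)) : Fin n := ⟨i + 1, by omega⟩

open Classical in
/-- The basis vector of the tableau obtained from `T` by exchanging two consecutive entries,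
or `0` if that tableau is not standard. -/
def swapVec (T : StandardTableau n μ) (i : Fin (n - 1)) : StandardTableau n μ →₀ ℂ :=
  if h : ∀ a b, T.box (Equiv.swap (lo i) (hi i) a) ≤ T.box (Equiv.swap (lo i) (hi i) b) → a ≤ b
  then Finsupp.single
    { box := fun a => T.box (Equiv.swap (lo i) (hi i) a)
      injective := T.injective.comp (Equiv.swap (lo i) (hi i)).injective
      range_eq := by
        rw [← T.range_eq]
        exact (Equiv.swap (lo i) (hi i)).surjective.range_comp T.box
      standard := h } 1
  else 0

/-- The diagonal coefficient `q ^ d / [d]_q` of Young's seminormal form, where `d` is the content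
of the larger of the two consecutive entries minus the content of the smaller one. -/
def diagCoeff (q : ℂ) (T : StandardTableau n μ) (i : Fin (n - 1)) : ℂ :=
  q ^ (T.content (hi i) - T.content (lo i)) / qNum q (T.content (hi i) - T.content (lo i))

end StandardTableau

/-- Young's seminormal form for `H_n(q)`: the operator by which the generator of index `i`
acts on the space spanned by the standard tableaux of shape `μ`,
`g T = α T + (1 + α) (s T)` with `α = q ^ d / [d]_q`. -/
def seminormal (n : ℕ) (q : ℂ) (μ : YoungDiagram) (i : Fin (n - 1)) :
    (StandardTableau n μ →₀ ℂ) →ₗ[ℂ] (StandardTableau n μ →₀ ℂ) :=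
  Finsupp.linearCombination ℂ fun T =>
    T.diagCoeff q i • Finsupp.single T 1 + (1 + T.diagCoeff q i) • T.swapVec i

/-- The representation `ρ` of `H_n(q)` is the one labelled by the Young diagram `μ` with `n` boxes:
it is isomorphic to Young's seminormal representation of shape `μ`. -/
def HasDiagram {n : ℕ} {q : ℂ} {V : Type*} [AddCommGroup V] [Module ℂ V]
    (ρ : Hecke n q →ₐ[ℂ] Module.End ℂ V) (μ : YoungDiagram) : Prop :=
  μ.card = n ∧
    ∃ e : V ≃ₗ[ℂ] (StandardTableau n μ →₀ ℂ), ∀ (i : Fin (n - 1)) (v : V),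
      e (ρ (gen n q (i + 1)) v) = seminormal n q μ i (e v)

/-- The representation of `H_n(q)` on a module over an algebra `B` that receives a
homomorphism `π` from `H_n(q)`. -/
def pullback {n : ℕ} {q : ℂ} {B : Type*} [Ring B] [Algebra ℂ B] (π : Hecke n q →ₐ[ℂ] B)
    (V : Type*) [AddCommGroup V] [Module ℂ V] [Module B V] [IsScalarTower ℂ B V] :
    Hecke n q →ₐ[ℂ] Module.End ℂ V :=
  (Algebra.lsmul ℂ ℂ V).comp π

/-- No irreducible representation of the algebra `B` (a quotient of `H_n(q)` by means of `π`) has,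
as a representation of `H_n(q)`, a Young diagram that contains `[lh ^ lv]`. -/
def ExcludesRect {n : ℕ} {q : ℂ} {B : Type*} [Ring B] [Algebra ℂ B] (π : Hecke n q →ₐ[ℂ] B)
    (lh lv : ℕ) : Prop :=
  ∀ (V : Type) [AddCommGroup V] [Module ℂ V] [Module B V] [IsScalarTower ℂ B V]
    [IsSimpleModule B V] (μ : YoungDiagram),
    HasDiagram (pullback π V) μ → ¬ rect lh lv ≤ μ

end HeckeRect

end

/-! Write N = lh * lv. The Murphy operators with i = 1 act diagonally in the seminormal basis: on
the vector of a tableau T the j-th one has eigenvalue q[c]_q, where c is the content of the box of j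
(`exists_basis_of_hasDiagram`). Hence Q^(1) is diagonal too. A shape with N boxes other than the
rectangle sticks out of it, so it contains the first box to the right of the top row or below the
left column. These have contents lh and -lv (`exists_ct_of_ne`), and a factor of C or R vanishes. If
the first N entries of T fill the rectangle, both numerators equal their denominators. So Q^(1)
projects onto the tableaux whose first N entries fill the rectangle, and such tableaux exist exactly
if the shape contains it. All Q^(i) are conjugate to Q^(1) by powers of g_1 ⋯ g_{n-1}, which settles
the other translates.

For a quotient B, vanishing of Q implies exclusion at once. The converse is an argument in the style
of Okounkov and Vershik that needs neither semisimplicity nor a classification of modules. Every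
module over the Hecke algebra is a sum of joint eigenspaces of the Jucys–Murphy elements, and their
eigenvalues come from contents of standard tableaux (`weights_of_le`). A joint eigenvector in B
generates, through intertwiners, a simple left ideal isomorphic to a seminormal representation
(`exists_simple_hasDiagram`). If no diagram containing the rectangle occurs, Q^(1) therefore kills
every joint eigenvector in B, hence also 1.

Positivity of q enters only through q ≠ 0 and [k]_q ≠ 0 for k ≠ 0. -/

noncomputable section

namespace HeckeRect

/-! ### Quantum integers and seminormal coefficients -/

/-- The parameter `q` is nonzero and no `q`-number `[k]_q` with `k ≠ 0` vanishes. -/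
structure QGeneric (q : ℂ) : Prop where
  ne_zero : q ≠ 0
  qNum_ne_zero : ∀ k : ℤ, k ≠ 0 → qNum q k ≠ 0

theorem qGeneric_ofReal {q : ℝ} (hq : 0 < q) : QGeneric (q : ℂ) := by
  refine ⟨by exact_mod_cast hq.ne', fun k hk => ?_⟩
  unfold qNum
  split_ifs with h
  · exact_mod_cast hk
  · have h1 : q ≠ 1 := by exact_mod_cast h
    refine div_ne_zero ?_ (sub_ne_zero.mpr h)
    rw [sub_ne_zero]
    intro h2
    have h3 : q ^ k = 1 := by exact_mod_cast h2
    rcases (zpow_eq_one_iff_of_ne_zero₀ hk).mp h3 with h4 | h4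
    · exact h1 h4
    · linarith [h4.1]

/-- The eigenvalue `q [k]_q` of a Murphy operator at a box of content `k`. -/
def jval (q : ℂ) (k : ℤ) : ℂ := q * qNum q k

/-- The coefficient `q ^ d / [d]_q` of Young's seminormal form. -/
def alpha (q : ℂ) (d : ℤ) : ℂ := q ^ d / qNum q d

@[simp] theorem qNum_zero (q : ℂ) : qNum q 0 = 0 := by simp [qNum]

@[simp] theorem qNum_one (q : ℂ) : qNum q 1 = 1 := by
  unfold qNum
  split_ifs with h
  · simp
  · rw [zpow_one, div_self (sub_ne_zero.mpr h)]

theorem qNum_add {q : ℂ} (hq : q ≠ 0) (a b : ℤ) :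
    qNum q (a + b) = qNum q a + q ^ a * qNum q b := by
  unfold qNum
  split_ifs with h
  · simp [h]
  · have := sub_ne_zero.mpr h
    rw [zpow_add₀ hq]
    field_simp
    ring

theorem qNum_mul_sub_one (q : ℂ) (a : ℤ) : (q - 1) * qNum q a = q ^ a - 1 := by
  unfold qNum
  split_ifs with h
  · simp [h]
  · have := sub_ne_zero.mpr h
    field_simp

@[simp] theorem jval_zero (q : ℂ) : jval q 0 = 0 := by simp [jval]

theorem kappa_jval {q : ℂ} (hq : q ≠ 0) (a : ℤ) : (q - 1) * jval q a + q = q ^ (a + 1) := by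
  have := qNum_mul_sub_one q a
  rw [zpow_add₀ hq, zpow_one, jval]
  linear_combination q * this

theorem jval_sub {q : ℂ} (hq : q ≠ 0) (a b : ℤ) :
    jval q a - jval q b = -(q ^ (a + 1) * qNum q (b - a)) := by
  have := qNum_add hq a (b - a)
  rw [add_sub_cancel] at this
  rw [jval, jval, this, zpow_add₀ hq, zpow_one]
  ring

theorem QGeneric.jval_injective {q : ℂ} (hq : QGeneric q) : Function.Injective (jval q) := by
  intro a b h
  by_contra hab
  have h1 := jval_sub hq.ne_zero a b
  rw [h, sub_self] at h1
  have := mul_ne_zero (zpow_ne_zero (a + 1) hq.ne_zero)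
    (hq.qNum_ne_zero (b - a) (sub_ne_zero.mpr (Ne.symm hab)))
  exact this (by linear_combination h1)

theorem one_add_alpha {q : ℂ} (hq : QGeneric q) {d : ℤ} (hd : d ≠ 0) :
    1 + alpha q d = qNum q (d + 1) / qNum q d := by
  have h1 := hq.qNum_ne_zero d hd
  rw [alpha, qNum_add hq.ne_zero, qNum_one]
  field_simp

theorem one_add_alpha_ne_zero {q : ℂ} (hq : QGeneric q) {d : ℤ} (hd : d ≠ 0) (hd1 : d ≠ -1) :
    1 + alpha q d ≠ 0 := by
  rw [one_add_alpha hq hd]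
  exact div_ne_zero (hq.qNum_ne_zero _ (by omega)) (hq.qNum_ne_zero d hd)

/-- On the block spanned by a tableau and its exchange the diagonal entries are `alpha q d` and
`alpha q (-d)`; their sum is the trace of a generator with eigenvalues `q` and `-1`. -/
theorem alpha_neg {q : ℂ} (hq : QGeneric q) {d : ℤ} (hd : d ≠ 0) :
    alpha q (-d) = q - 1 - alpha q d := by
  have h0 := hq.ne_zero
  have h1 := hq.qNum_ne_zero d hd
  have h2 := hq.qNum_ne_zero (-d) (by omega)
  have h3 := qNum_add h0 d (-d)
  rw [add_neg_cancel, qNum_zero] at h3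
  have h4 := qNum_mul_sub_one q d
  have h5 : q ^ d * q ^ (-d) = 1 := by rw [← zpow_add₀ h0]; simp
  have h6 : q ^ d ≠ 0 := zpow_ne_zero _ h0
  have h7 : alpha q (-d) * qNum q d = -1 := by
    rw [alpha, div_mul_eq_mul_div, div_eq_iff h2]
    apply mul_left_cancel₀ h6
    linear_combination qNum q d * h5 - h3
  have h8 : alpha q d * qNum q d = q ^ d := by rw [alpha]; field_simp
  apply mul_right_cancel₀ h1
  linear_combination h7 - h4 + h8

/-- Turns the scalar terms of `phi` on a joint eigenvector into a multiple of `alpha`, see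
`phi_apply`. -/
theorem alpha_mul_jval_sub {q : ℂ} (hq : QGeneric q) {a b : ℤ} (h : a ≠ b) :
    alpha q (b - a) * (jval q a - jval q b) = -((q - 1) * jval q b + q) := by
  have h1 := hq.qNum_ne_zero (b - a) (by omega)
  rw [jval_sub hq.ne_zero, kappa_jval hq.ne_zero, alpha,
    show b + 1 = (a + 1) + (b - a) by ring, zpow_add₀ hq.ne_zero (a + 1)]
  field_simp

theorem alpha_one {q : ℂ} : alpha q 1 = q := by simp [alpha]

theorem alpha_neg_one {q : ℂ} (hq : QGeneric q) : alpha q (-1) = -1 := by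
  rw [alpha_neg hq one_ne_zero, alpha_one]; ring

/-! ### Jucys–Murphy elements and intertwiners -/

section Algebra

variable {A : Type*} [Ring A] [Algebra ℂ A]

/-- Elements `s 0, …, s (n - 2)` that satisfy the relations of the Hecke algebra `H_n(q)`. -/
structure HeckeRelations (n : ℕ) (q : ℂ) (s : ℕ → A) : Prop where
  quad : ∀ j, j + 1 < n → s j * s j = (q - 1) • s j + q • (1 : A)
  braid : ∀ j, j + 2 < n → s j * s (j + 1) * s j = s (j + 1) * s j * s (j + 1)
  comm : ∀ i j, i + 2 ≤ j → j + 1 < n → Commute (s i) (s j)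

/-- The Jucys–Murphy elements, by their recursion. -/
def jm (q : ℂ) (s : ℕ → A) : ℕ → A
  | 0 => 0
  | j + 1 => s j + q⁻¹ • (s j * jm q s j * s j)

theorem jm_succ (q : ℂ) (s : ℕ → A) (j : ℕ) :
    jm q s (j + 1) = s j + q⁻¹ • (s j * jm q s j * s j) := rfl

namespace HeckeRelations

variable {n : ℕ} {q : ℂ} {s : ℕ → A}

theorem commute_jm_of_lt (h : HeckeRelations n q s) {i j : ℕ} (hij : j < i) (hi : i + 1 < n) :
    Commute (s i) (jm q s j) := by
  induction j with
  | zero => exact Commute.zero_right _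
  | succ j ih =>
    have h1 : Commute (s i) (s j) := (h.comm j i (by omega) hi).symm
    have h2 := ih (by omega)
    exact h1.add_right (((h1.mul_right h2).mul_right h1).smul_right _)

/-- The substance is the case `j = i + 2`, where both `s i` and `s (i + 1)` enter; beyond it every
new generator commutes with `s i`. -/
theorem commute_jm_of_gt (h : HeckeRelations n q s) (hq : q ≠ 0) {i j : ℕ} (hij : i + 2 ≤ j)
    (hj : j < n) : Commute (s i) (jm q s j) := by
  induction j with
  | zero => omega
  | succ j ih =>
    rcases Nat.lt_or_ge (i + 1) j with h0 | h0
    · have h1 : Commute (s i) (s j) := h.comm i j (by omega) hj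
      have h2 := ih (by omega) (by omega)
      exact h1.add_right (((h1.mul_right h2).mul_right h1).smul_right _)
    · obtain rfl : j = i + 1 := by omega
      have hz : Commute (s (i + 1)) (jm q s i) := h.commute_jm_of_lt (by omega) hj
      have hb := h.braid i hj
      have hqd := h.quad i (by omega)
      rw [jm_succ, jm_succ]
      set g := s (i + 1)
      set a := s i
      set Z := jm q s i
      -- The innermost part is conjugated by `g * a`; since `Z` commutes with `g`, two braid moves
      -- carry `a` across it.
      have e1 : a * (g * (a * Z * a) * g) = g * (a * Z * a) * g * a := by
        calc a * (g * (a * Z * a) * g) = (a * g * a) * Z * a * g := by noncomm_ring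
          _ = g * a * (g * Z) * a * g := by rw [hb]; noncomm_ring
          _ = g * a * Z * (g * a * g) := by rw [hz.eq]; noncomm_ring
          _ = g * (a * Z * a) * g * a := by rw [← hb]; noncomm_ring
      -- Neither `g` nor `g * a * g` commutes with `a`, but `g + q⁻¹ • (g * a * g)` does: both
      -- products with `a` equal `a * g + g * a` plus the same multiple of `a * g * a`.
      have e2 : a * (g * a * g) = (q - 1) • (a * g * a) + q • (g * a) := by
        rw [← hb]
        calc a * (a * g * a) = (a * a) * g * a := by noncomm_ring
          _ = _ := by rw [hqd]; simp only [add_mul, smul_mul_assoc, one_mul, mul_assoc]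
      have e3 : (g * a * g) * a = (q - 1) • (a * g * a) + q • (a * g) := by
        rw [← hb]
        calc (a * g * a) * a = a * g * (a * a) := by noncomm_ring
          _ = _ := by rw [hqd]; simp only [mul_add, mul_smul_comm, mul_one, mul_assoc]
      have e4 : q⁻¹ * q = 1 := inv_mul_cancel₀ hq
      change a * (g + q⁻¹ • (g * (a + q⁻¹ • (a * Z * a)) * g))
        = (g + q⁻¹ • (g * (a + q⁻¹ • (a * Z * a)) * g)) * a
      simp only [mul_add, add_mul, mul_smul_comm, smul_mul_assoc, smul_add, smul_smul]
      rw [e1, e2, e3]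
      simp only [smul_add, smul_smul, e4, one_smul]
      abel

theorem commute_jm_jm (h : HeckeRelations n q s) (hq : q ≠ 0) {i j : ℕ} (hi : i < n)
    (hj : j < n) : Commute (jm q s i) (jm q s j) := by
  wlog hij : i ≤ j generalizing i j
  · exact (this hj hi (by omega)).symm
  rcases hij.eq_or_lt with rfl | hij
  · exact Commute.refl _
  induction i with
  | zero => exact Commute.zero_left _
  | succ i ih =>
    have h1 := h.commute_jm_of_gt hq (show i + 2 ≤ j by omega) hj
    have h2 := ih (by omega) (by omega) (by omega)
    exact h1.add_left (((h1.mul_left h2).mul_left h1).smul_left _)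

theorem mul_jm_succ (h : HeckeRelations n q s) (hq : q ≠ 0) {j : ℕ} (hj : j + 1 < n) :
    s j * jm q s (j + 1) = (q - 1) • jm q s (j + 1) + q • (1 : A) + jm q s j * s j := by
  have hqd := h.quad j hj
  have e4 : q * q⁻¹ = 1 := mul_inv_cancel₀ hq
  rw [jm_succ]
  set X := jm q s j
  set g := s j
  have e1 : g * (g * X * g) = (q - 1) • (g * X * g) + q • (X * g) := by
    calc g * (g * X * g) = (g * g) * X * g := by noncomm_ring
      _ = _ := by rw [hqd]; simp only [add_mul, smul_mul_assoc, one_mul]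
  rw [mul_add, hqd, mul_smul_comm, e1]
  simp only [smul_add, smul_smul, mul_comm q⁻¹, e4, one_smul]
  module

theorem jm_succ_mul (h : HeckeRelations n q s) (hq : q ≠ 0) {j : ℕ} (hj : j + 1 < n) :
    jm q s (j + 1) * s j = (q - 1) • jm q s (j + 1) + q • (1 : A) + s j * jm q s j := by
  have hqd := h.quad j hj
  have e4 : q * q⁻¹ = 1 := mul_inv_cancel₀ hq
  rw [jm_succ]
  set X := jm q s j
  set g := s j
  have e1 : (g * X * g) * g = (q - 1) • (g * X * g) + q • (g * X) := by
    rw [mul_assoc (g * X), hqd]; simp only [mul_add, mul_smul_comm, mul_one]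
  rw [add_mul, hqd, smul_mul_assoc, e1]
  simp only [smul_add, smul_smul, mul_comm q⁻¹, e4, one_smul]
  module

end HeckeRelations

/-- The intertwiner that exchanges `jm j` and `jm (j + 1)`. -/
def phi (q : ℂ) (s : ℕ → A) (j : ℕ) : A :=
  s j * (jm q s j - jm q s (j + 1)) + (q - 1) • jm q s (j + 1) + q • (1 : A)

namespace HeckeRelations

variable {n : ℕ} {q : ℂ} {s : ℕ → A}

/-- The correction terms of `phi` cancel the inhomogeneous part of the cross relation `mul_jm_succ`.
-/
theorem jm_mul_phi (h : HeckeRelations n q s) (hq : q ≠ 0) {j : ℕ} (hj : j + 1 < n) :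
    jm q s j * phi q s j = phi q s j * jm q s (j + 1) := by
  have h1 := h.mul_jm_succ hq hj
  have h2 := (h.commute_jm_jm hq (show j < n by omega) hj).eq
  unfold phi
  set X := jm q s j
  set Y := jm q s (j + 1)
  set g := s j
  have h3 : X * g = g * Y - (q - 1) • Y - q • (1 : A) := by rw [h1]; abel
  simp only [mul_add, add_mul, ← mul_assoc, h3]
  simp only [sub_mul, mul_sub, smul_mul_assoc, mul_smul_comm, one_mul, mul_one, mul_assoc, h2]
  module

theorem jm_succ_mul_phi (h : HeckeRelations n q s) (hq : q ≠ 0) {j : ℕ} (hj : j + 1 < n) :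
    jm q s (j + 1) * phi q s j = phi q s j * jm q s j := by
  have h1 := h.jm_succ_mul hq hj
  have h2 := (h.commute_jm_jm hq (show j < n by omega) hj).eq
  unfold phi
  set X := jm q s j
  set Y := jm q s (j + 1)
  set g := s j
  simp only [mul_add, add_mul, ← mul_assoc, h1]
  simp only [sub_mul, mul_sub, smul_mul_assoc, mul_smul_comm, one_mul, mul_one, mul_assoc, h2]
  module

theorem jm_mul_phi_of_ne (h : HeckeRelations n q s) (hq : q ≠ 0) {i j : ℕ} (hj : j + 1 < n)
    (hi : i < n) (hij : i ≠ j) (hij' : i ≠ j + 1) : Commute (jm q s i) (phi q s j) := by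
  have h1 := h.commute_jm_jm hq hi (show j < n by omega)
  have h2 := h.commute_jm_jm hq hi hj
  have h3 : Commute (jm q s i) (s j) := by
    rcases Nat.lt_or_ge i j with h0 | h0
    · exact (h.commute_jm_of_lt h0 hj).symm
    · exact (h.commute_jm_of_gt hq (by omega) hi).symm
  exact ((h3.mul_right (h1.sub_right h2)).add_right (h2.smul_right _)).add_right
    ((Commute.one_right _).smul_right _)

/-- The square of the intertwiner lies in the commutative algebra of the Jucys–Murphy elements, so
on a joint eigenvector it is a scalar, which tells where an exchange may fail. -/
theorem phi_mul_phi (h : HeckeRelations n q s) (hq : q ≠ 0) {j : ℕ} (hj : j + 1 < n) :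
    phi q s j * phi q s j =
      ((q - 1) • jm q s j + q • (1 : A)) * ((q - 1) • jm q s (j + 1) + q • (1 : A))
        - q • ((jm q s j - jm q s (j + 1)) * (jm q s j - jm q s (j + 1))) := by
  have h0 := h.quad j hj
  have h1 := h.jm_mul_phi hq hj
  have h1' := h.jm_succ_mul_phi hq hj
  have h2 := (h.commute_jm_jm hq (show j < n by omega) hj).eq
  have e0 : phi q s j = s j * (jm q s j - jm q s (j + 1)) + (q - 1) • jm q s (j + 1)
    + q • (1 : A) := rfl
  generalize phi q s j = P at *
  generalize jm q s j = X at *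
  generalize jm q s (j + 1) = Y at *
  generalize s j = g at *
  have h3 : P * P = g * P * (Y - X) + (q - 1) • (P * X) + q • P := by
    nth_rewrite 1 [e0]
    rw [add_mul, add_mul, mul_assoc, sub_mul, h1, h1', ← mul_sub, ← mul_assoc, smul_mul_assoc, h1',
      smul_mul_assoc, one_mul]
  have h4 : g * P = ((q - 1) • g + q • (1 : A)) * (X - Y) + (q - 1) • (g * Y) + q • g := by
    rw [e0, mul_add, mul_add, ← mul_assoc, h0, mul_smul_comm, mul_smul_comm, mul_one]
  rw [h3, h4, e0]
  simp only [sub_mul, mul_sub, smul_mul_assoc, mul_smul_comm, one_mul, mul_one, mul_assoc, h2,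
    add_mul, mul_add, smul_add, smul_sub]
  module

end HeckeRelations

end Algebra

/-! ### Standard tableaux as sequences of boxes -/

/-- The content (column minus row) of a box. -/
def ct (x : ℕ × ℕ) : ℤ := (x.2 : ℤ) - (x.1 : ℤ)

/-- The boxes `T 0, …, T (m - 1)`, in this order, form a standard tableau: they are distinct and
every box is preceded by all boxes to its north-west. -/
structure IsStd (m : ℕ) (T : ℕ → ℕ × ℕ) : Prop where
  inj : ∀ a < m, ∀ b < m, T a = T b → a = b
  lower : ∀ b < m, ∀ x ≤ T b, ∃ a ≤ b, T a = x

/-- The tableau `T` with the entries in positions `j` and `j + 1` exchanged. -/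
def swapAt (T : ℕ → ℕ × ℕ) (j : ℕ) : ℕ → ℕ × ℕ := fun a => T (Equiv.swap j (j + 1) a)

@[simp] theorem swapAt_left (T : ℕ → ℕ × ℕ) (j : ℕ) : swapAt T j j = T (j + 1) := by
  simp [swapAt]

@[simp] theorem swapAt_right (T : ℕ → ℕ × ℕ) (j : ℕ) : swapAt T j (j + 1) = T j := by
  simp [swapAt]

theorem swapAt_of_ne (T : ℕ → ℕ × ℕ) {j a : ℕ} (h1 : a ≠ j) (h2 : a ≠ j + 1) :
    swapAt T j a = T a := by
  simp [swapAt, Equiv.swap_apply_of_ne_of_ne h1 h2]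

@[simp] theorem swapAt_swapAt (T : ℕ → ℕ × ℕ) (j : ℕ) : swapAt (swapAt T j) j = T := by
  funext a; simp [swapAt]

theorem swap_lt {m j a : ℕ} (hj : j + 1 < m) (ha : a < m) : Equiv.swap j (j + 1) a < m := by
  rw [Equiv.swap_apply_def]
  split_ifs <;> omega

theorem image_swapAt (T : ℕ → ℕ × ℕ) {m j : ℕ} (hj : j + 1 < m) :
    swapAt T j '' Set.Iio m = T '' Set.Iio m := by
  ext x
  constructor
  · rintro ⟨a, ha, rfl⟩
    exact ⟨_, swap_lt hj ha, rfl⟩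
  · rintro ⟨a, ha, rfl⟩
    exact ⟨Equiv.swap j (j + 1) a, swap_lt hj ha, by simp [swapAt]⟩

namespace IsStd

variable {m : ℕ} {T T' : ℕ → ℕ × ℕ}

theorem mono (h : IsStd m T) {k : ℕ} (hk : k ≤ m) : IsStd k T :=
  ⟨fun a ha b hb => h.inj a (by omega) b (by omega), fun b hb => h.lower b (by omega)⟩

theorem le_of_le (h : IsStd m T) {a b : ℕ} (ha : a < m) (hb : b < m) (hab : T a ≤ T b) :
    a ≤ b := by
  obtain ⟨a', h1, h2⟩ := h.lower b hb _ hab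
  have := h.inj a' (by omega) a ha h2
  omega

/-- Two different boxes that can be added to the same diagram have contents at distance at
least two. -/
theorem two_le_of_ne {k : ℕ} (h : IsStd (k + 1) T) (h' : IsStd (k + 1) T')
    (hT : ∀ a < k, T a = T' a) (hne : T k ≠ T' k) :
    ct (T k) + 2 ≤ ct (T' k) ∨ ct (T' k) + 2 ≤ ct (T k) := by
  have h1 : ¬ T k ≤ T' k := by
    intro hle
    obtain ⟨a, ha, hae⟩ := h'.lower k (by omega) _ hle
    rcases ha.eq_or_lt with rfl | ha
    · exact hne hae.symm
    · rw [← hT a ha] at hae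
      have := h.inj a (by omega) k (by omega) hae
      omega
  have h2 : ¬ T' k ≤ T k := by
    intro hle
    obtain ⟨a, ha, hae⟩ := h.lower k (by omega) _ hle
    rcases ha.eq_or_lt with rfl | ha
    · exact hne hae
    · rw [hT a ha] at hae
      have := h'.inj a (by omega) k (by omega) hae
      omega
  -- Of two incomparable boxes one is strictly higher and strictly farther right, so both
  -- coordinates contribute at least one to the difference of contents.
  rw [Prod.le_def] at h1 h2
  unfold ct
  omega

/-- At the first disagreement both boxes could be added to the same diagram, so their contents
differ. Hence joint eigenvalues determine the tableau. -/
theorem eq_of_ct_eq (h : IsStd m T) (h' : IsStd m T') (hc : ∀ a < m, ct (T a) = ct (T' a)) :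
    ∀ a < m, T a = T' a := by
  intro a
  induction a using Nat.strong_induction_on with
  | _ a ih =>
    intro ha
    by_contra hne
    have := two_le_of_ne (h.mono (show a + 1 ≤ m by omega)) (h'.mono (by omega))
      (fun b hb => ih b hb (by omega)) hne
    have := hc a ha
    omega

theorem swapAt (h : IsStd m T) {j : ℕ} (hj : j + 1 < m) (hle : ¬ T j ≤ T (j + 1)) :
    IsStd m (swapAt T j) := by
  refine ⟨fun a ha b hb hab => ?_, fun b hb x hx => ?_⟩
  · exact (Equiv.swap j (j + 1)).injective (h.inj _ (swap_lt hj ha) _ (swap_lt hj hb) hab)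
  · obtain ⟨a, ha, rfl⟩ := h.lower _ (swap_lt hj hb) x hx
    refine ⟨Equiv.swap j (j + 1) a, ?_, by simp [HeckeRect.swapAt]⟩
    -- This is the only case in which the exchange could reverse the order of two comparable boxes.
    have key : ¬ (a = j ∧ b = j) := by
      rintro ⟨rfl, rfl⟩
      rw [swapAt_left] at hx
      exact hle hx
    rw [Equiv.swap_apply_def] at ha ⊢
    split_ifs at ha ⊢ <;> omega

/-- Compare `T` with its exchange: both boxes can be added to the diagram of the first `j` boxes. -/
theorem two_le_of_not_le (h : IsStd m T) {j : ℕ} (hj : j + 1 < m) (hle : ¬ T j ≤ T (j + 1)) :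
    ct (T j) + 2 ≤ ct (T (j + 1)) ∨ ct (T (j + 1)) + 2 ≤ ct (T j) := by
  have h1 := (h.swapAt hj hle).mono (show j + 1 ≤ m by omega)
  have h2 := two_le_of_ne (h.mono (show j + 1 ≤ m by omega)) h1
    (fun a ha => (swapAt_of_ne T (by omega) (by omega)).symm)
  rw [swapAt_left] at h2
  apply h2
  intro h3
  have := h.inj j (by omega) (j + 1) hj h3
  omega

/-- A further box between the two would need an entry strictly between `j` and `j + 1`; hence they
are neighbours in a row or a column. -/
theorem ct_of_le (h : IsStd m T) {j : ℕ} (hj : j + 1 < m) (hle : T j ≤ T (j + 1)) :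
    ct (T (j + 1)) = ct (T j) + 1 ∨ ct (T (j + 1)) = ct (T j) - 1 := by
  have key : ∀ x, T j ≤ x → x ≤ T (j + 1) → x ≠ T (j + 1) → x = T j := by
    intro x h1 h2 h3
    obtain ⟨a, ha, rfl⟩ := h.lower _ hj x h2
    have h4 : a ≠ j + 1 := by rintro rfl; exact h3 rfl
    have h5 := h.le_of_le (by omega) (by omega) h1
    rw [show a = j by omega]
  have hne : T j ≠ T (j + 1) := fun h3 => by
    have := h.inj j (by omega) (j + 1) hj h3
    omega
  unfold ct
  clear h
  generalize T j = x at *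
  generalize T (j + 1) = y at *
  obtain ⟨r, c⟩ := x
  obtain ⟨r', c'⟩ := y
  simp only [Prod.mk_le_mk, ne_eq, Prod.mk.injEq, Prod.forall] at *
  by_cases hc : c < c'
  · have := key r' (c' - 1) (by omega) (by omega) (by omega)
    omega
  · have := key (r' - 1) c' (by omega) (by omega) (by omega)
    omega

theorem ct_ne (h : IsStd m T) {j : ℕ} (hj : j + 1 < m) : ct (T j) ≠ ct (T (j + 1)) := by
  by_cases hle : T j ≤ T (j + 1)
  · have := h.ct_of_le hj hle; omega
  · have := h.two_le_of_not_le hj hle; omega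

/-- A tableau can be extended by any box all of whose predecessors it contains. -/
theorem update (h : IsStd m T) {x : ℕ × ℕ} (hx : ∀ a < m, T a ≠ x)
    (hlow : ∀ y ≤ x, y ≠ x → ∃ a < m, T a = y) : IsStd (m + 1) (Function.update T m x) := by
  have e : ∀ a < m, Function.update T m x a = T a := fun a ha =>
    Function.update_of_ne (by omega) _ _
  refine ⟨fun a ha b hb hab => ?_, fun b hb y hy => ?_⟩
  · rcases (Nat.lt_succ_iff.mp ha).eq_or_lt with rfl | ha <;>
      rcases (Nat.lt_succ_iff.mp hb).eq_or_lt with rfl | hb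
    · rfl
    · rw [Function.update_self, e b hb] at hab
      exact (hx b hb hab.symm).elim
    · rw [Function.update_self, e a ha] at hab
      exact (hx a ha hab).elim
    · rw [e a ha, e b hb] at hab
      exact h.inj a ha b hb hab
  · rcases (Nat.lt_succ_iff.mp hb).eq_or_lt with rfl | hb
    · rw [Function.update_self] at hy
      by_cases hyx : y = x
      · exact ⟨b, le_rfl, by rw [Function.update_self, hyx]⟩
      · obtain ⟨a, ha, hay⟩ := hlow y hy hyx
        exact ⟨a, ha.le, by rw [e a ha, hay]⟩
    · rw [e b hb] at hy
      obtain ⟨a, ha, hay⟩ := h.lower b hb y hy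
      exact ⟨a, ha, by rw [e a (by omega), hay]⟩

end IsStd

/-- A box that is maximal among the first `t` boxes can be moved to position `t - 1` by
exchanges of incomparable neighbours. -/
theorem exists_maximal_last {m t : ℕ} (P : (ℕ → ℕ × ℕ) → Prop)
    (hP : ∀ T j, P T → IsStd m T → j + 1 < t → ¬ T j ≤ T (j + 1) → P (swapAt T j)) (ht : t ≤ m)
    {x : ℕ × ℕ} : ∀ (d k : ℕ) (T : ℕ → ℕ × ℕ), k + d + 1 = t → P T → IsStd m T → T k = x →
      (∀ i < t, x ≤ T i → i = k) → ∃ T', P T' ∧ IsStd m T' ∧ T' (t - 1) = x := by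
  intro d
  induction d with
  | zero =>
    intro k T hk hPT hT hx _
    exact ⟨T, hPT, hT, by rw [← hx]; congr 1; omega⟩
  | succ d ih =>
    intro k T hk hPT hT hx hmax
    have hle : ¬ T k ≤ T (k + 1) := by
      intro hle
      rw [hx] at hle
      have := hmax _ (by omega) hle
      omega
    refine ih (k + 1) (swapAt T k) (by omega) (hP T k hPT hT (by omega) hle)
      (hT.swapAt (by omega) hle) (by rw [swapAt_right, hx]) fun i hi hxi => ?_
    have := hmax _ (swap_lt (by omega) hi) hxi
    rw [Equiv.swap_apply_def] at this
    split_ifs at this <;> omega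

/-- Any two standard tableaux of the same shape are connected by exchanges of incomparable
neighbours. -/
theorem IsStd.connected {m : ℕ} (P : (ℕ → ℕ × ℕ) → Prop)
    (hP : ∀ T j, P T → IsStd m T → j + 1 < m → ¬ T j ≤ T (j + 1) → P (HeckeRect.swapAt T j))
    {T T' : ℕ → ℕ × ℕ} (hT : IsStd m T) (hT' : IsStd m T')
    (him : T '' Set.Iio m = T' '' Set.Iio m) (hout : ∀ i, m ≤ i → T i = T' i) (h : P T) :
    P T' := by
  -- Agreement with `T'` is produced on the last `d` positions. The box due at position `t` is
  -- maximal among the first `t + 1` boxes, because both tableaux have the same set of boxes there.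
  have key : ∀ d ≤ m, ∃ T1, (P T1 ∧ T1 '' Set.Iio m = T' '' Set.Iio m ∧
      ∀ i, m - d ≤ i → T1 i = T' i) ∧ IsStd m T1 := by
    intro d
    induction d with
    | zero => exact fun _ => ⟨T, ⟨h, him, hout⟩, hT⟩
    | succ d ih =>
      intro hd
      obtain ⟨T1, ⟨hP1, him1, hag⟩, hT1⟩ := ih (by omega)
      obtain ⟨t, ht⟩ : ∃ t, m - d = t + 1 := ⟨m - d - 1, by omega⟩
      rw [ht] at hag
      obtain ⟨k, hk, hkx⟩ : T' t ∈ T1 '' Set.Iio m := him1 ▸ ⟨t, show t < m by omega, rfl⟩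
      have hk : k < m := hk
      have hkt : k ≤ t := by
        by_contra hlt
        have h1 := hag k (by omega)
        rw [hkx] at h1
        have := hT'.inj _ (by omega) _ hk h1
        omega
      obtain ⟨T2, ⟨⟨hP2, him2, hag2⟩, hT2, hT2t⟩⟩ := exists_maximal_last (m := m) (t := t + 1)
        (fun T => P T ∧ T '' Set.Iio m = T' '' Set.Iio m ∧ ∀ i, t + 1 ≤ i → T i = T' i)
        (fun T j hT hs hj hle => ⟨hP T j hT.1 hs (by omega) hle,
          by rw [image_swapAt T (by omega), hT.2.1],
          fun i hi => by rw [swapAt_of_ne T (by omega) (by omega), hT.2.2 i hi]⟩)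
        (by omega) (t - k) k T1 (by omega) ⟨hP1, him1, hag⟩ hT1 hkx
        (by
          intro i hi hle
          obtain ⟨i', hi', hie⟩ : T1 i ∈ T' '' Set.Iio m := him1 ▸ ⟨i, show i < m by omega, rfl⟩
          have hi' : i' < m := hi'
          have h1 : i' ≤ t := by
            by_contra hlt
            have h2 := hag i' (by omega)
            rw [hie] at h2
            have := hT1.inj _ (by omega) _ (by omega) h2
            omega
          rw [← hie] at hle
          have h3 := hT'.le_of_le (by omega) hi' hle
          have h4 : i' = t := by omega
          rw [h4, ← hkx] at hie
          exact hT1.inj _ (by omega) _ hk hie.symm)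
      refine ⟨T2, ⟨hP2, him2, fun i hi => ?_⟩, hT2⟩
      rcases Nat.lt_or_ge t i with h1 | h1
      · exact hag2 i h1
      · obtain rfl : i = t := by omega
        simpa using hT2t
  obtain ⟨T1, ⟨hP1, -, hag⟩, -⟩ := key m le_rfl
  rwa [show T' = T1 from funext fun i => (hag i (by omega)).symm]

/-- A standard tableau extends to a standard tableau of any larger finite diagram. -/
theorem IsStd.exists_extension {E : Finset (ℕ × ℕ)} (hE : IsLowerSet (E : Set (ℕ × ℕ))) :
    ∀ (d m : ℕ) (T : ℕ → ℕ × ℕ), IsStd m T → (∀ a < m, T a ∈ E) → m + d = E.card →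
      ∃ T', IsStd E.card T' ∧ (∀ a < E.card, T' a ∈ E) ∧ ∀ a < m, T' a = T a := by
  classical
  intro d
  induction d with
  | zero =>
    intro m T hT hTE hm
    obtain rfl : m = E.card := by omega
    exact ⟨T, hT, hTE, fun _ _ => rfl⟩
  | succ d ih =>
    intro m T hT hTE hm
    have hne : (E \ (Finset.range m).image T).Nonempty := by
      rw [← Finset.card_pos]
      have h1 := Finset.le_card_sdiff ((Finset.range m).image T) E
      have h2 : ((Finset.range m).image T).card ≤ m := by
        simpa using Finset.card_image_le (s := Finset.range m) (f := T)
      omega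
    obtain ⟨x, hx⟩ := (E \ (Finset.range m).image T).exists_minimal hne
    have hxE := Finset.mem_sdiff.mp hx.1
    have hxT : ∀ a < m, T a ≠ x := fun a ha h =>
      hxE.2 (Finset.mem_image.mpr ⟨a, Finset.mem_range.mpr ha, h⟩)
    have hlow : ∀ y ≤ x, y ≠ x → ∃ a < m, T a = y := by
      intro y hy hyx
      by_contra hcon
      push Not at hcon
      have hyE : y ∈ E := hE hy hxE.1
      have : y ∈ E \ (Finset.range m).image T := by
        simp only [Finset.mem_sdiff, hyE, Finset.mem_image, Finset.mem_range, true_and]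
        rintro ⟨a, ha, h⟩
        exact hcon a ha h
      exact hyx (le_antisymm hy (hx.2 this hy))
    obtain ⟨T', h1, h2, h3⟩ := ih (m + 1) _ (hT.update hxT hlow) (by
      intro a ha
      by_cases h : a = m
      · rw [h, Function.update_self]; exact hxE.1
      · rw [Function.update_of_ne h]; exact hTE a (by omega)) (by omega)
    exact ⟨T', h1, h2, fun a ha => by rw [h3 a (by omega), Function.update_of_ne (by omega)]⟩

/-! ### Joint eigenspaces -/

section Operators

variable {M : Type*} [AddCommGroup M] [Module ℂ M]

/-- If a sum of joint eigenvectors with pairwise different joint eigenvalues lies in an invariant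
submodule, so do all of its terms. -/
theorem mem_of_sum_mem {ι κ : Type*} (L : ι → Module.End ℂ M) (I : Set ι) (N : Submodule ℂ M)
    (hN : ∀ i ∈ I, ∀ v ∈ N, L i v ∈ N) (χ : κ → ι → ℂ) :
    ∀ (S : Finset κ) (u : κ → M), (∀ k ∈ S, ∀ i ∈ I, L i (u k) = χ k i • u k) →
      (∀ k ∈ S, ∀ l ∈ S, k ≠ l → ∃ i ∈ I, χ k i ≠ χ l i) → ∑ k ∈ S, u k ∈ N →
      ∀ k ∈ S, u k ∈ N := by
  classical
  intro S
  induction S using Finset.strongInduction with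
  | H S ih =>
    intro u hu hχ hsum k hk
    by_cases hS : ∃ l ∈ S, l ≠ k
    · obtain ⟨l, hl, hlk⟩ := hS
      obtain ⟨i, hi, hne⟩ := hχ k hk l hl hlk.symm
      -- Applying `L i - χ l i` removes the term `l` and multiplies the term `k` by a nonzero
      -- scalar.
      have h1 : ∑ k ∈ S.erase l, (χ k i - χ l i) • u k ∈ N := by
        have h2 : L i (∑ k ∈ S, u k) - χ l i • ∑ k ∈ S, u k ∈ N :=
          N.sub_mem (hN i hi _ hsum) (N.smul_mem _ hsum)
        rw [map_sum, Finset.smul_sum, ← Finset.sum_sub_distrib, ← Finset.add_sum_erase _ _ hl] at h2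
        rw [hu l hl i hi, sub_self, zero_add] at h2
        have h4 : ∑ k ∈ S.erase l, (χ k i - χ l i) • u k =
            ∑ k ∈ S.erase l, (L i (u k) - χ l i • u k) := Finset.sum_congr rfl fun j hj => by
          rw [hu j (Finset.mem_of_mem_erase hj) i hi, sub_smul]
        rwa [h4]
      have h3 := ih (S.erase l) (Finset.erase_ssubset hl) (fun k => (χ k i - χ l i) • u k)
        (fun j hj i' hi' => by
          rw [map_smul, hu j (Finset.mem_of_mem_erase hj) i' hi', smul_comm])
        (fun a ha b hb => hχ a (Finset.mem_of_mem_erase ha) b (Finset.mem_of_mem_erase hb)) h1 k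
        (Finset.mem_erase.mpr ⟨hlk.symm, hk⟩)
      exact (N.smul_mem_iff (sub_ne_zero.mpr hne)).mp h3
    · push Not at hS
      rwa [Finset.sum_eq_single_of_mem k hk fun l hl hlk => (hlk (hS l hl)).elim] at hsum

/-- An invariant submodule is compatible with the decomposition into eigenspaces. -/
theorem mem_iSup_inf_eigenspace {κ : Type*} {X : Module.End ℂ M} {χ : κ → ℂ}
    (hχ : Function.Injective χ) {K : Submodule ℂ M} (hK : ∀ v ∈ K, X v ∈ K) {u : M} (hu : u ∈ K)
    (hu' : u ∈ ⨆ b, X.eigenspace (χ b)) : u ∈ ⨆ b, K ⊓ X.eigenspace (χ b) := by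
  obtain ⟨f, hf, hfu⟩ := (Submodule.mem_iSup_iff_exists_finsupp _ _).mp hu'
  have h1 := mem_of_sum_mem (fun _ : Unit => X) Set.univ K (fun _ _ => hK) (fun b _ => χ b)
    f.support f (fun b _ _ _ => Module.End.mem_eigenspace_iff.mp (hf b))
    (fun a _ b _ hab => ⟨(), trivial, hχ.ne hab⟩) (by rw [← hfu] at hu; exact hu)
  rw [← hfu]
  exact Submodule.sum_mem _ fun b hb => Submodule.mem_iSup_of_mem b ⟨h1 b hb, hf b⟩

/-- `Y - y` is invertible on the sum of the eigenspaces for `S`, so some `v` there satisfies `(Y -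
y) v = (Y - y) w`, and `w - v` is an eigenvector for `y`. -/
theorem mem_sup_eigenspace {κ : Type*} {Y : Module.End ℂ M} {χ : κ → ℂ} {S : Set κ} {y : ℂ}
    (hy : ∀ b ∈ S, χ b ≠ y) {w : M} (hw : Y w - y • w ∈ ⨆ b ∈ S, Y.eigenspace (χ b)) :
    w ∈ (⨆ b ∈ S, Y.eigenspace (χ b)) ⊔ Y.eigenspace y := by
  have key : ∀ u ∈ ⨆ b ∈ S, Y.eigenspace (χ b),
      ∃ v ∈ ⨆ b ∈ S, Y.eigenspace (χ b), Y v - y • v = u := by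
    intro u hu
    have : (⨆ b ∈ S, Y.eigenspace (χ b)) ≤
        Submodule.map (Y - y • LinearMap.id) (⨆ b ∈ S, Y.eigenspace (χ b)) := by
      refine iSup₂_le fun b hb v hv => ?_
      have hv' := Module.End.mem_eigenspace_iff.mp hv
      refine ⟨(χ b - y)⁻¹ • v, Submodule.smul_mem _ _
        (Submodule.mem_iSup_of_mem b (Submodule.mem_iSup_of_mem hb hv)), ?_⟩
      simp only [LinearMap.sub_apply, LinearMap.smul_apply, LinearMap.id_apply, map_smul, hv']
      rw [← sub_smul, smul_smul,
        inv_mul_cancel₀ (sub_ne_zero.mpr (hy b hb)), one_smul]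
    obtain ⟨v, hv, hvu⟩ := this hu
    exact ⟨v, hv, by simpa using hvu⟩
  obtain ⟨v, hv, hvw⟩ := key _ hw
  have h1 : w - v ∈ Y.eigenspace y := by
    rw [Module.End.mem_eigenspace_iff, map_sub, smul_sub, sub_eq_sub_iff_sub_eq_sub, hvw]
  have := Submodule.add_mem_sup hv h1
  rwa [add_sub_cancel] at this

variable (q : ℂ) (s : ℕ → Module.End ℂ M)

/-- The joint eigenspace of the first `m` Jucys–Murphy operators with the eigenvalues that belong
to the contents `c`. -/
def wt (m : ℕ) (c : ℕ → ℤ) : Submodule ℂ M where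
  carrier := {w | ∀ j < m, jm q s j w = jval q (c j) • w}
  add_mem' := fun ha hb j hj => by rw [map_add, ha j hj, hb j hj, smul_add]
  zero_mem' := fun j _ => by simp
  smul_mem' := fun r w hw j hj => by rw [map_smul, hw j hj, smul_comm]

variable {q s}

theorem mem_wt {m : ℕ} {c : ℕ → ℤ} {w : M} :
    w ∈ wt q s m c ↔ ∀ j < m, jm q s j w = jval q (c j) • w := Iff.rfl

theorem wt_mono {m k : ℕ} (hk : k ≤ m) {c : ℕ → ℤ} {w : M} (hw : w ∈ wt q s m c) :
    w ∈ wt q s k c := fun j hj => hw j (by omega)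

theorem wt_congr {m : ℕ} {c c' : ℕ → ℤ} (h : ∀ j < m, c j = c' j) {w : M}
    (hw : w ∈ wt q s m c) : w ∈ wt q s m c' := fun j hj => by rw [← h j hj]; exact hw j hj

theorem mem_wt_succ {m : ℕ} {c : ℕ → ℤ} {w : M} :
    w ∈ wt q s (m + 1) c ↔ w ∈ wt q s m c ∧ jm q s m w = jval q (c m) • w := by
  simp only [mem_wt, Nat.lt_succ_iff_lt_or_eq, or_imp, forall_and, forall_eq]

variable {n : ℕ} (h : HeckeRelations n q s) (hq : QGeneric q)
include h hq

theorem jm_mem_wt {m i : ℕ} {c : ℕ → ℤ} (hm : m ≤ n) (hi : i < n) {w : M}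
    (hw : w ∈ wt q s m c) : jm q s i w ∈ wt q s m c := by
  intro j hj
  rw [← Module.End.mul_apply, (h.commute_jm_jm hq.ne_zero (show j < n by omega) hi).eq,
    Module.End.mul_apply, hw j hj, map_smul]

/-- The contents after an exchange of two neighbours. -/
def swapC (c : ℕ → ℤ) (j : ℕ) : ℕ → ℤ := fun a => c (Equiv.swap j (j + 1) a)

theorem phi_mem_wt {m j : ℕ} {c : ℕ → ℤ} (hm : m ≤ n) (hj : j + 1 < m) {w : M}
    (hw : w ∈ wt q s m c) : phi q s j w ∈ wt q s m (swapC c j) := by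
  intro i hi
  unfold swapC
  by_cases h1 : i = j
  · subst h1
    rw [← Module.End.mul_apply, h.jm_mul_phi hq.ne_zero (by omega), Module.End.mul_apply,
      hw _ hj, map_smul, Equiv.swap_apply_left]
  by_cases h2 : i = j + 1
  · subst h2
    rw [← Module.End.mul_apply, h.jm_succ_mul_phi hq.ne_zero (by omega), Module.End.mul_apply,
      hw j (by omega), map_smul, Equiv.swap_apply_right]
  · rw [← Module.End.mul_apply, (h.jm_mul_phi_of_ne hq.ne_zero (by omega) (by omega) h1 h2).eq,
      Module.End.mul_apply, hw i hi, map_smul, Equiv.swap_apply_of_ne_of_ne h1 h2]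

omit h in
/-- The intertwiner on a joint eigenvector. -/
theorem phi_apply {j : ℕ} {a b : ℤ} {w : M} (hab : a ≠ b) (h1 : jm q s j w = jval q a • w)
    (h2 : jm q s (j + 1) w = jval q b • w) :
    phi q s j w = (jval q a - jval q b) • (s j w - alpha q (b - a) • w) := by
  have h3 := alpha_mul_jval_sub hq hab
  simp only [phi, LinearMap.add_apply, Module.End.mul_apply, LinearMap.sub_apply,
    LinearMap.smul_apply, Module.End.one_apply, h1, h2, map_sub, map_smul]
  rw [smul_sub, smul_smul (jval q a - jval q b), mul_comm (jval q a - jval q b), h3]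
  module

/-- Only `jm q s j` is assumed to act by a scalar: the square becomes a quadratic polynomial in `jm
q s (j + 1)` with roots at the contents `a - 1` and `a + 1`. This form serves before the latter
operator is known to be diagonalizable. -/
theorem phi_phi_apply {j : ℕ} (hj : j + 1 < n) {a : ℤ} {w : M}
    (h1 : jm q s j w = jval q a • w) :
    phi q s j (phi q s j w) = (-q) •
      (jm q s (j + 1) (jm q s (j + 1) w - jval q (a - 1) • w) -
        jval q (a + 1) • (jm q s (j + 1) w - jval q (a - 1) • w)) := by
  have h0 := hq.ne_zero
  have h2 : jm q s j (jm q s (j + 1) w) = jval q a • jm q s (j + 1) w := by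
    rw [← Module.End.mul_apply, (h.commute_jm_jm h0 (show j < n by omega) hj).eq,
      Module.End.mul_apply, h1, map_smul]
  have e1 : jval q (a + 1) = q + q * jval q a := by
    rw [jval, jval, add_comm a, qNum_add h0, qNum_one, zpow_one]; ring
  have e2 : jval q a = q + q * jval q (a - 1) := by
    conv_lhs => rw [jval, show a = 1 + (a - 1) by ring, qNum_add h0, qNum_one, zpow_one]
    rw [jval]; ring
  rw [← Module.End.mul_apply, h.phi_mul_phi h0 hj]
  simp only [LinearMap.add_apply, Module.End.mul_apply, LinearMap.sub_apply,
    LinearMap.smul_apply, Module.End.one_apply, h1, h2, map_sub, map_smul, map_add, e1]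
  generalize jm q s (j + 1) (jm q s (j + 1) w) = w2
  generalize jm q s (j + 1) w = w1
  rw [e2]
  module

theorem phi_phi_of_wt {j : ℕ} (hj : j + 1 < n) {a b : ℤ} {w : M}
    (h1 : jm q s j w = jval q a • w) (h2 : jm q s (j + 1) w = jval q b • w) :
    phi q s j (phi q s j w) =
      (-q * ((jval q b - jval q (a - 1)) * (jval q b - jval q (a + 1)))) • w := by
  rw [phi_phi_apply h hq hj h1]
  simp only [h2, map_sub, map_smul]
  module

theorem phi_ne_zero {j : ℕ} (hj : j + 1 < n) {a b : ℤ} {w : M} (hw : w ≠ 0)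
    (h1 : jm q s j w = jval q a • w) (h2 : jm q s (j + 1) w = jval q b • w)
    (hb1 : b ≠ a - 1) (hb2 : b ≠ a + 1) : phi q s j w ≠ 0 := by
  intro h0
  have h3 := phi_phi_of_wt h hq hj h1 h2
  rw [h0, map_zero] at h3
  have := smul_ne_zero (mul_ne_zero (neg_ne_zero.mpr hq.ne_zero) (mul_ne_zero
    (sub_ne_zero.mpr (hq.jval_injective.ne hb1)) (sub_ne_zero.mpr (hq.jval_injective.ne hb2)))) hw
  exact this h3.symm

theorem sub_smul_jm_apply_s {j : ℕ} (hj : j + 1 < n) {a : ℤ} {w : M}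
    (h2 : jm q s (j + 1) w = jval q a • w) :
    jm q s j (s j w) - jval q a • s j w = (-q ^ (a + 1)) • w := by
  have h3 := LinearMap.congr_fun (h.mul_jm_succ hq.ne_zero hj) w
  simp only [LinearMap.add_apply, Module.End.mul_apply, LinearMap.smul_apply,
    Module.End.one_apply, h2, map_smul] at h3
  rw [← kappa_jval hq.ne_zero, h3]
  module

/-- Two consecutive Jucys–Murphy operators, the first of which is diagonalizable, do not have equal
eigenvalues on a common eigenvector. -/
theorem eq_zero_of_equal {j : ℕ} (hj : j + 1 < n)
    (hdiag : ⨆ b : ℤ, (jm q s j).eigenspace (jval q b) = ⊤) {a : ℤ} {w : M}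
    (h1 : jm q s j w = jval q a • w) (h2 : jm q s (j + 1) w = jval q a • w) : w = 0 := by
  -- A nonzero `w` would be the image of `s j w` under `jm q s j - jval q a`, up to a nonzero
  -- factor: a Jordan chain. By diagonalizability that image lies in the sum of the other
  -- eigenspaces.
  have h3 := sub_smul_jm_apply_s h hq hj h2
  have h4 : (jm q s j) (s j w) - jval q a • s j w ∈
      ⨆ b ∈ {b : ℤ | b ≠ a}, (jm q s j).eigenspace (jval q b) := by
    have : (⊤ : Submodule ℂ M) ≤ Submodule.comap (jm q s j - jval q a • LinearMap.id)
        (⨆ b ∈ {b : ℤ | b ≠ a}, (jm q s j).eigenspace (jval q b)) := by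
      rw [← hdiag]
      refine iSup_le fun b v hv => ?_
      have hv' := Module.End.mem_eigenspace_iff.mp hv
      simp only [Submodule.mem_comap, LinearMap.sub_apply, LinearMap.smul_apply,
        LinearMap.id_apply, hv', ← sub_smul]
      by_cases hb : b = a
      · simp [hb]
      · exact Submodule.smul_mem _ _
          (Submodule.mem_iSup_of_mem b (Submodule.mem_iSup_of_mem hb hv))
    exact this (x := s j w) trivial
  rw [h3] at h4
  have h5 := ((Module.End.eigenspaces_iSupIndep (jm q s j)).comp hq.jval_injective) a
  rw [Submodule.disjoint_def] at h5
  have h6 : (-q ^ (a + 1)) • w ∈ (jm q s j).eigenspace (jval q a) :=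
    Submodule.smul_mem _ _ (Module.End.mem_eigenspace_iff.mpr h1)
  have h7 := h5 _ h6 h4
  exact (smul_eq_zero.mp h7).resolve_left (neg_ne_zero.mpr (zpow_ne_zero _ hq.ne_zero))

end Operators

/-! ### Weights of arbitrary modules are content sequences -/

section Levels

variable {M : Type*} [AddCommGroup M] [Module ℂ M] {q : ℂ} {s : ℕ → Module.End ℂ M} {n : ℕ}
variable (h : HeckeRelations n q s) (hq : QGeneric q)

theorem iSup_eigenspace_jm {m : ℕ} (hA : ⨆ c, wt q s m c = ⊤) {j : ℕ} (hj : j < m) :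
    ⨆ b : ℤ, (jm q s j).eigenspace (jval q b) = ⊤ := by
  rw [eq_top_iff, ← hA]
  exact iSup_le fun c w hw => Submodule.mem_iSup_of_mem (c j)
    (Module.End.mem_eigenspace_iff.mpr (hw j hj))

theorem wt_one (c : ℕ → ℤ) (hc : c 0 = 0) : wt q s 1 c = ⊤ := by
  rw [eq_top_iff]
  intro w _ j hj
  obtain rfl : j = 0 := by omega
  simp [jm, hc]

include h hq

/-- Decompose `phi q s k w` into eigenvectors of `X`; by the known weights none belongs to the
contents `c k ± 1`. A second `phi` turns them into eigenvectors of `Y` and yields a quadratic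
polynomial in `Y` applied to `w`. Its two roots are distinct and not among those eigenvalues, so two
uses of `mem_sup_eigenspace` recover `w`. -/
theorem iSup_wt_succ {k : ℕ} (hk : k + 2 ≤ n) (hA : ⨆ c, wt q s (k + 1) c = ⊤)
    (hB : ∀ c w, w ≠ 0 → w ∈ wt q s (k + 1) c →
      ∃ T, IsStd (k + 1) T ∧ ∀ j < k + 1, ct (T j) = c j) :
    ⨆ c, wt q s (k + 2) c = ⊤ := by
  rw [eq_top_iff, ← hA]
  refine iSup_le fun c w hw => ?_
  by_cases hw0 : w = 0
  · rw [hw0]; exact Submodule.zero_mem _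
  obtain ⟨T, hT, hTc⟩ := hB c w hw0 hw
  set X := jm q s k 
  set Y := jm q s (k + 1) 
  set S : Set ℤ := {b | b ≠ c k - 1 ∧ b ≠ c k + 1}
  have hXw : X w = jval q (c k) • w := hw k (by omega)
  have h1 : phi q s k w ∈ wt q s k c := by
    intro i hi
    rw [← Module.End.mul_apply, (h.jm_mul_phi_of_ne hq.ne_zero (by omega) (by omega)
      (by omega) (by omega)).eq, Module.End.mul_apply, hw i (by omega), map_smul]
  have h2 : phi q s k w ∈ ⨆ b, wt q s k c ⊓ X.eigenspace (jval q b) :=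
    mem_iSup_inf_eigenspace hq.jval_injective
      (fun v hv => jm_mem_wt h hq (by omega) (by omega) hv) h1
      (by rw [iSup_eigenspace_jm hA (by omega)]; trivial)
  have h3 : phi q s k w ∈ ⨆ b ∈ S, X.eigenspace (jval q b) := by
    refine (iSup_le fun b v hv => ?_ :
      (⨆ b, wt q s k c ⊓ X.eigenspace (jval q b)) ≤ _) h2
    by_cases hv0 : v = 0
    · rw [hv0]; exact Submodule.zero_mem _
    have hv' : v ∈ wt q s (k + 1) (Function.update c k b) := by
      rw [mem_wt_succ]
      refine ⟨wt_congr (fun j hj => (Function.update_of_ne (by omega) _ _).symm) hv.1, ?_⟩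
      rw [Function.update_self]
      exact Module.End.mem_eigenspace_iff.mp hv.2
    obtain ⟨T', hT', hTc'⟩ := hB _ v hv0 hv'
    have hlow := (hT.mono (show k ≤ k + 1 by omega)).eq_of_ct_eq (hT'.mono (by omega))
      (fun a ha => by
        rw [hTc a (by omega), hTc' a (by omega), Function.update_of_ne (by omega)])
    have hb : ct (T' k) = b := by rw [hTc' k (by omega), Function.update_self]
    have ha : ct (T k) = c k := hTc k (by omega)
    -- The contents `b` and `c k` belong to boxes that can be added to the same diagram, so they are
    -- equal or at least two apart.
    have hbS : b ∈ S := by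
      by_cases hne : T k = T' k
      · rw [hne] at ha
        exact ⟨by omega, by omega⟩
      · have := IsStd.two_le_of_ne hT hT' hlow hne
        exact ⟨by omega, by omega⟩
    exact Submodule.mem_iSup_of_mem b (Submodule.mem_iSup_of_mem hbS hv.2)
  have h4 : phi q s k (phi q s k w) ∈ ⨆ b ∈ S, Y.eigenspace (jval q b) := by
    refine (iSup₂_le fun b hb v hv => ?_ : (⨆ b ∈ S, X.eigenspace (jval q b)) ≤
      Submodule.comap (phi q s k) (⨆ b ∈ S, Y.eigenspace (jval q b))) h3
    refine Submodule.mem_iSup_of_mem b (Submodule.mem_iSup_of_mem hb ?_)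
    rw [Module.End.mem_eigenspace_iff, ← Module.End.mul_apply,
      h.jm_succ_mul_phi hq.ne_zero (by omega), Module.End.mul_apply,
      Module.End.mem_eigenspace_iff.mp hv, map_smul]
  rw [phi_phi_apply h hq (by omega) hXw,
    Submodule.smul_mem_iff _ (neg_ne_zero.mpr hq.ne_zero)] at h4
  have h5 := mem_sup_eigenspace (fun b hb => hq.jval_injective.ne hb.2) h4
  have h6 : Y w - jval q (c k - 1) • w ∈
      ⨆ b ∈ {b : ℤ | b ≠ c k - 1}, Y.eigenspace (jval q b) := by
    refine (sup_le (iSup₂_le fun b hb => ?_) ?_ :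
      (⨆ b ∈ S, Y.eigenspace (jval q b)) ⊔ Y.eigenspace (jval q (c k + 1)) ≤ _) h5
    · exact le_iSup₂_of_le b hb.1 le_rfl
    · exact le_iSup₂_of_le (c k + 1) (show c k + 1 ≠ c k - 1 by omega) le_rfl
  have h7 := mem_sup_eigenspace (fun b hb => hq.jval_injective.ne hb) h6
  have h8 : w ∈ ⨆ b, Y.eigenspace (jval q b) := by
    refine (sup_le (iSup₂_le fun b _ => ?_) ?_ : (⨆ b ∈ {b : ℤ | b ≠ c k - 1},
      Y.eigenspace (jval q b)) ⊔ Y.eigenspace (jval q (c k - 1)) ≤ _) h7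
    · exact le_iSup_of_le b le_rfl
    · exact le_iSup_of_le (c k - 1) le_rfl
  have h9 := mem_iSup_inf_eigenspace hq.jval_injective
      (fun v hv => jm_mem_wt h hq (show k + 1 ≤ n by omega) (by omega) hv) hw h8
  refine (iSup_le fun b v hv => ?_ :
      (⨆ b, wt q s (k + 1) c ⊓ Y.eigenspace (jval q b)) ≤ _) h9
  refine Submodule.mem_iSup_of_mem (Function.update c (k + 1) b) ?_
  rw [mem_wt_succ]
  refine ⟨wt_congr (fun j hj => (Function.update_of_ne (by omega) _ _).symm) hv.1, ?_⟩
  rw [Function.update_self]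
  exact Module.End.mem_eigenspace_iff.mp hv.2

/-- No joint eigenvector has contents `b, a, b` with `b = a ± 1` in consecutive positions. -/
theorem no_braid_pattern {l : ℕ} (hl : l + 3 ≤ n)
    (hB : ∀ c w, w ≠ 0 → w ∈ wt q s (l + 2) c →
      ∃ T, IsStd (l + 2) T ∧ ∀ j < l + 2, ct (T j) = c j)
    {c : ℕ → ℤ} {w : M} (hw : w ∈ wt q s (l + 3) c) (h0 : c (l + 2) = c l)
    (h1 : c (l + 1) = c l + 1 ∨ c (l + 1) = c l - 1) : w = 0 := by
  by_contra hw0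
  obtain ⟨T, hT, hTc⟩ := hB c w hw0 (wt_mono (by omega) hw)
  have hne : jval q (c l) ≠ jval q (c (l + 1)) := hq.jval_injective.ne (by omega)
  have hx := hw l (by omega)
  have hy := hw (l + 1) (by omega)
  have hz := hw (l + 2) (by omega)
  -- A nonzero image would give two boxes that can be added to the same diagram with contents one
  -- apart.
  have hp1 : phi q s l w = 0 := by
    by_contra hp
    obtain ⟨T', hT', hTc'⟩ := hB _ _ hp (wt_mono (by omega)
      (phi_mem_wt h hq (show l + 3 ≤ n by omega) (by omega) hw))
    have hlow := (hT.mono (show l ≤ l + 2 by omega)).eq_of_ct_eq (hT'.mono (by omega))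
      (fun a ha => by
        rw [hTc a (by omega), hTc' a (by omega), swapC,
          Equiv.swap_apply_of_ne_of_ne (by omega) (by omega)])
    have e1 := hTc l (by omega)
    have e2 := hTc' l (by omega)
    rw [swapC, Equiv.swap_apply_left] at e2
    have := IsStd.two_le_of_ne (hT.mono (show l + 1 ≤ l + 2 by omega)) (hT'.mono (by omega)) hlow
      (fun e => by rw [e] at e1; omega)
    omega
  -- A nonzero image would have equal contents in the consecutive positions `l` and `l + 1`.
  have hp2 : phi q s (l + 1) w = 0 := by
    by_contra hp
    obtain ⟨T', hT', hTc'⟩ := hB _ _ hp (wt_mono (by omega)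
      (phi_mem_wt h hq (show l + 3 ≤ n by omega) (by omega) hw))
    apply hT'.ct_ne (show l + 1 < l + 2 by omega)
    rw [hTc' l (by omega), hTc' (l + 1) (by omega), swapC, swapC, Equiv.swap_apply_left,
      Equiv.swap_apply_of_ne_of_ne (by omega) (by omega), h0]
  rw [phi_apply hq (by omega) hx hy, smul_eq_zero, or_iff_right (sub_ne_zero.mpr hne),
    sub_eq_zero] at hp1
  rw [phi_apply hq (by omega) hy hz, h0, smul_eq_zero,
    or_iff_right (sub_ne_zero.mpr hne.symm), sub_eq_zero] at hp2
  -- Both generators now act on `w` by scalars, one by `q` and the other by `-1`; the braid relation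
  -- forces them to be equal, against [2]_q ≠ 0.
  have hb := LinearMap.congr_fun (h.braid l (by omega)) w
  simp only [Module.End.mul_apply, hp1, hp2, map_smul, smul_smul] at hb
  have hb' := smul_left_injective ℂ hw0 hb
  have h2 : q + 1 ≠ 0 := by
    have := hq.qNum_ne_zero 2 (by norm_num)
    rwa [show (2 : ℤ) = 1 + 1 by norm_num, qNum_add hq.ne_zero, qNum_one, zpow_one, mul_one,
      add_comm] at this
  have hq0 := hq.ne_zero
  rcases h1 with h1 | h1
  · rw [h1, show c l + 1 - c l = 1 by ring, show c l - (c l + 1) = -1 by ring, alpha_one,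
      alpha_neg_one hq] at hb'
    exact mul_ne_zero hq0 h2 (by linear_combination -hb')
  · rw [h1, show c l - 1 - c l = -1 by ring, show c l - (c l - 1) = 1 by ring, alpha_one,
      alpha_neg_one hq] at hb'
    exact mul_ne_zero hq0 h2 (by linear_combination hb')

/-- If no box of content `b` could be added to the diagram `D`, then intertwiners would rearrange
the tableau until the last three contents are `b`, `b ± 1`, `b`, which `no_braid_pattern` forbids.
-/
theorem exists_isStd_succ {k : ℕ} (hk : k + 2 ≤ n) (hA : ⨆ c, wt q s (k + 1) c = ⊤)
    (hB : ∀ c w, w ≠ 0 → w ∈ wt q s (k + 1) c →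
      ∃ T, IsStd (k + 1) T ∧ ∀ j < k + 1, ct (T j) = c j)
    {c : ℕ → ℤ} {w : M} (hw0 : w ≠ 0) (hw : w ∈ wt q s (k + 2) c) :
    ∃ T, IsStd (k + 2) T ∧ ∀ j < k + 2, ct (T j) = c j := by
  by_contra hcon
  obtain ⟨T, hT, hTc⟩ := hB c w hw0 (wt_mono (by omega) hw)
  set b := c (k + 1) with hb
  set D := T '' Set.Iio (k + 1) with hD
  have hnadd : ∀ x, ct x = b → x ∉ D → ∃ z ≤ x, z ≠ x ∧ z ∉ D := by
    intro x hx hxD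
    by_contra hno
    push Not at hno
    refine hcon ⟨_, hT.update (x := x) (fun a ha e => hxD ⟨a, ha, e⟩)
      (fun y hy hyx => hno y hy hyx), fun j hj => ?_⟩
    by_cases hjk : j = k + 1
    · rw [hjk, Function.update_self, hx]
    · rw [Function.update_of_ne hjk, hTc j (by omega)]
  -- Tableaux of shape `D` that still carry a nonzero weight vector with next content `b`; exchanges
  -- of incomparable neighbours preserve this.
  set P : (ℕ → ℕ × ℕ) → Prop := fun T => T '' Set.Iio (k + 1) = D ∧
    ∃ w ≠ 0, w ∈ wt q s (k + 2) (Function.update (fun j => ct (T j)) (k + 1) b) with hPdef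
  have hPT : P T := by
    refine ⟨rfl, w, hw0, wt_congr (fun j hj => ?_) hw⟩
    by_cases hjk : j = k + 1
    · rw [hjk, Function.update_self]
    · rw [Function.update_of_ne hjk, hTc j (by omega)]
  have hPswap : ∀ T j, P T → IsStd (k + 1) T → j + 1 < k + 1 → ¬ T j ≤ T (j + 1) →
      P (swapAt T j) := by
    rintro T j ⟨hTD, w, hw0, hw⟩ hT hj hle
    refine ⟨by rw [image_swapAt T hj, hTD], phi q s j w, ?_, ?_⟩
    · have h1 := hT.two_le_of_not_le hj hle
      have h2 := hw j (by omega)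
      have h3 := hw (j + 1) (by omega)
      rw [Function.update_of_ne (by omega)] at h2 h3
      exact phi_ne_zero h hq (by omega) hw0 h2 h3 (by omega) (by omega)
    · refine wt_congr (fun i hi => ?_) (phi_mem_wt h hq hk (by omega) hw)
      unfold swapC
      by_cases hik : i = k + 1
      · rw [hik, Equiv.swap_apply_of_ne_of_ne (by omega) (by omega), Function.update_self,
          Function.update_self]
      · have := swap_lt hj (show i < k + 1 by omega)
        rw [Function.update_of_ne (by omega), Function.update_of_ne hik, swapAt]
  -- Otherwise `phi q s k w` is nonzero, and its tableau has at position `k` a box of content `b`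
  -- that could be added to `D`.
  have hadj : ∀ T, P T → IsStd (k + 1) T → b = ct (T k) + 1 ∨ b = ct (T k) - 1 := by
    rintro T ⟨hTD, w, hw0, hw⟩ hT
    by_contra hno
    have h2 := hw k (by omega)
    have h3 := hw (k + 1) (by omega)
    rw [Function.update_of_ne (by omega)] at h2
    rw [Function.update_self] at h3
    have hba : b ≠ ct (T k) := by
      intro e
      rw [e] at h3
      exact hw0 (eq_zero_of_equal h hq (by omega) (iSup_eigenspace_jm hA (by omega)) h2 h3)
    have hp := phi_ne_zero h hq (by omega) hw0 h2 h3 (by omega) (by omega)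
    obtain ⟨T', hT', hTc'⟩ := hB _ _ hp (wt_mono (by omega)
      (phi_mem_wt h hq hk (by omega) hw))
    have hlow := (hT.mono (show k ≤ k + 1 by omega)).eq_of_ct_eq (hT'.mono (by omega))
      (fun a ha => by
        rw [hTc' a (by omega), swapC, Equiv.swap_apply_of_ne_of_ne (by omega) (by omega),
          Function.update_of_ne (by omega)])
    have hy : ct (T' k) = b := by
      rw [hTc' k (by omega), swapC, Equiv.swap_apply_left, Function.update_self]
    have hyD : T' k ∉ D := by
      rw [← hTD]
      rintro ⟨i, hi, hie⟩
      have hi : i < k + 1 := hi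
      by_cases hik : i = k
      · rw [hik] at hie; rw [hie] at hba; exact hba hy.symm
      · rw [hlow i (by omega)] at hie
        have := hT'.inj i (by omega) k (by omega) hie
        omega
    obtain ⟨z, hz, hzy, hzD⟩ := hnadd _ hy hyD
    obtain ⟨a, ha, rfl⟩ := hT'.lower k (by omega) z hz
    have hak : a ≠ k := by rintro rfl; exact hzy rfl
    rw [← hTD] at hzD
    exact hzD ⟨a, show a < k + 1 by omega, hlow a (by omega)⟩
  have hmem : ∀ y ∈ D, T k ≤ y → y = T k := by
    rintro y ⟨i, hi, rfl⟩ hle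
    have hi : i < k + 1 := hi
    have := hT.le_of_le (by omega) hi hle
    rw [show i = k by omega]
  have hdown : ∀ y ≤ T k, y ∈ D := by
    intro y hy
    obtain ⟨a, ha, hay⟩ := hT.lower k (by omega) y hy
    exact ⟨a, show a < k + 1 by omega, hay⟩
  have hDlow : ∀ y ∈ D, ∀ z ≤ y, z ∈ D := by
    rintro y ⟨i, hi, rfl⟩ z hz
    have hi : i < k + 1 := hi
    obtain ⟨a, ha, hay⟩ := hT.lower i (by omega) z hz
    exact ⟨a, show a < k + 1 by omega, hay⟩
  -- The outer neighbour of `T k` with content `b` lies outside `D` and cannot be added, so a box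
  -- before it is missing. Hence the inner neighbour `u` of content `b`, above or to the left of `T
  -- k`, exists and is maximal in `D` once `T k` is removed.
  obtain ⟨u, hux, hune, hub, humax⟩ : ∃ u ≤ T k, u ≠ T k ∧ ct u = b ∧
      ∀ y ∈ D, u ≤ y → y ≠ T k → y = u := by
    rcases hadj T hPT hT with hb1 | hb1
    · obtain ⟨⟨r', c'⟩, hz, hzne, hzD⟩ := hnadd ((T k).1, (T k).2 + 1)
        (by simp only [ct] at hb1 ⊢; push_cast; omega)
        (fun hy => by
          have := congrArg Prod.snd (hmem _ hy ⟨le_rfl, Nat.le_succ _⟩)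
          simp at this)
      have hz2 : ¬ (r', c') ≤ T k := fun hle => hzD (hdown _ hle)
      generalize T k = x at *
      obtain ⟨r, d⟩ := x
      simp only [Prod.mk_le_mk, ne_eq, Prod.mk.injEq, ct] at *
      refine ⟨(r - 1, d), by simp only [Prod.mk_le_mk]; omega,
        by simp only [Prod.mk.injEq]; omega, by simp only; omega, ?_⟩
      rintro ⟨p, p'⟩ hy hle hne
      have h1 : ¬ (r', c') ≤ (p, p') := fun hle' => hzD (hDlow _ hy _ hle')
      have h2 := hmem _ hy
      simp only [Prod.mk_le_mk, Prod.mk.injEq] at *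
      omega
    · obtain ⟨⟨r', c'⟩, hz, hzne, hzD⟩ := hnadd ((T k).1 + 1, (T k).2)
        (by simp only [ct] at hb1 ⊢; push_cast; omega)
        (fun hy => by
          have := congrArg Prod.fst (hmem _ hy ⟨Nat.le_succ _, le_rfl⟩)
          simp at this)
      have hz2 : ¬ (r', c') ≤ T k := fun hle => hzD (hdown _ hle)
      generalize T k = x at *
      obtain ⟨r, d⟩ := x
      simp only [Prod.mk_le_mk, ne_eq, Prod.mk.injEq, ct] at *
      refine ⟨(r, d - 1), by simp only [Prod.mk_le_mk]; omega,
        by simp only [Prod.mk.injEq]; omega, by simp only; omega, ?_⟩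
      rintro ⟨p, p'⟩ hy hle hne
      have h1 : ¬ (r', c') ≤ (p, p') := fun hle' => hzD (hDlow _ hy _ hle')
      have h2 := hmem _ hy
      simp only [Prod.mk_le_mk, Prod.mk.injEq] at *
      omega
  obtain ⟨k', hk', hk'u⟩ := hdown u hux
  have hk' : k' < k + 1 := hk'
  have hk'k : k' ≠ k := by rintro rfl; exact hune hk'u.symm
  -- Move `u` to position `k - 1`, directly before `T k`, which stays last.
  obtain ⟨T1, ⟨hP1, hT1x⟩, hT1, hT1u⟩ := exists_maximal_last (m := k + 1) (t := k)
    (fun T1 => P T1 ∧ T1 k = T k)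
    (fun T j hT hs hj hle => ⟨hPswap T j hT.1 hs (by omega) hle, by
      rw [swapAt_of_ne T (by omega) (by omega), hT.2]⟩) (by omega) (k - 1 - k') k' T (by omega)
    ⟨hPT, rfl⟩ hT hk'u (fun i hi hle => by
      have h1 := humax (T i) ⟨i, show i < k + 1 by omega, rfl⟩ hle
        (fun e => by have := hT.inj i (by omega) k (by omega) e; omega)
      exact hT.inj i (by omega) k' hk' (h1.trans hk'u.symm))
  have hb1 := hadj T hPT hT
  obtain ⟨l, rfl⟩ : ∃ l, k = l + 1 := ⟨k - 1, by omega⟩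
  obtain ⟨-, w1, hw10, hw1⟩ := hP1
  rw [Nat.add_sub_cancel] at hT1u
  refine hw10 (no_braid_pattern h hq (l := l) hk hB hw1 ?_ ?_)
  · rw [Function.update_self, Function.update_of_ne (by omega), hT1u, hub]
  · rw [Function.update_of_ne (by omega), Function.update_of_ne (by omega), hT1u, hub, hT1x]
    omega

/-- Every module over the Hecke algebra is the sum of the joint eigenspaces of the Jucys–Murphy
operators, and the joint eigenvalues are given by the contents of standard tableaux. -/
theorem weights_of_le : ∀ m ≤ n, (⨆ c, wt q s m c = ⊤) ∧
    ∀ c w, w ≠ 0 → w ∈ wt q s m c → ∃ T, IsStd m T ∧ ∀ j < m, ct (T j) = c j := by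
  intro m
  induction m with
  | zero =>
    intro _
    refine ⟨?_, fun c w _ _ => ⟨fun _ => 0, ⟨?_, ?_⟩, ?_⟩⟩
    · rw [eq_top_iff]
      exact fun w _ => Submodule.mem_iSup_of_mem 0 fun j hj => by omega
    all_goals intro j hj; omega
  | succ m ih =>
    intro hm
    obtain ⟨hA, hB⟩ := ih (by omega)
    rcases m with - | k
    · refine ⟨?_, fun c w hw0 hw => ?_⟩
      · rw [eq_top_iff, ← wt_one (q := q) (s := s) 0 rfl]
        exact le_iSup (fun c => wt q s 1 c) 0
      · have h1 := hw 0 (by omega)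
        rw [jm, LinearMap.zero_apply, eq_comm, smul_eq_zero, or_iff_left hw0,
          ← jval_zero q] at h1
        refine ⟨fun _ => (0, 0), ⟨fun a ha b hb _ => by omega, fun b hb x hx => ⟨b, le_rfl, ?_⟩⟩,
          fun j hj => ?_⟩
        · rw [Prod.le_def] at hx
          ext <;> simp only at * <;> omega
        · obtain rfl : j = 0 := by omega
          rw [hq.jval_injective h1]
          simp [ct]
    · exact ⟨iSup_wt_succ h hq hm hA hB, fun c w hw0 hw =>
        exists_isStd_succ h hq hm hA hB hw0 hw⟩

end Levels

/-- The scalar identity behind the braid relation `psi_braid`. -/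
theorem alpha_triangle {q : ℂ} (hq : QGeneric q) {d e : ℤ} (hd : d ≠ 0) (he : e ≠ 0)
    (hde : d + e ≠ 0) :
    alpha q (d + e) * (alpha q d + alpha q e - (q - 1)) = alpha q d * alpha q e := by
  have h1 := hq.qNum_ne_zero d hd
  have h2 := hq.qNum_ne_zero e he
  have h3 := hq.qNum_ne_zero _ hde
  have h4 := qNum_add hq.ne_zero d e
  have h5 := qNum_mul_sub_one q e
  rw [alpha, alpha, alpha, zpow_add₀ hq.ne_zero]
  field_simp
  rw [h4]
  linear_combination -(q ^ d * q ^ e * qNum q d) * h5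

/-! ### From one joint eigenvector to a seminormal basis -/

section Family

variable {M : Type*} [AddCommGroup M] [Module ℂ M] {q : ℂ} {s : ℕ → Module.End ℂ M} {n : ℕ}

/-- The normalized intertwiner between the joint eigenspaces with contents `a, b` and `b, a` in
positions `j, j + 1`. -/
def psi (q : ℂ) (s : ℕ → Module.End ℂ M) (j : ℕ) (a b : ℤ) : Module.End ℂ M :=
  (1 + alpha q (b - a))⁻¹ • (s j - alpha q (b - a) • 1)

theorem psi_apply (q : ℂ) (s : ℕ → Module.End ℂ M) (j : ℕ) (a b : ℤ) (w : M) :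
    psi q s j a b w = (1 + alpha q (b - a))⁻¹ • (s j w - alpha q (b - a) • w) := by
  simp [psi]

theorem s_apply_eq (hq : QGeneric q) {j : ℕ} {a b : ℤ} (hab : a ≠ b) (hab' : b ≠ a - 1) (w : M) :
    s j w = alpha q (b - a) • w + (1 + alpha q (b - a)) • psi q s j a b w := by
  rw [psi_apply, smul_smul, mul_inv_cancel₀ (one_add_alpha_ne_zero hq (by omega) (by omega))]
  module

variable (h : HeckeRelations n q s) (hq : QGeneric q)

include h hq

/-- With `x + y = q - 1` the quadratic relation makes `(s j - x) (s j - y)` the scalar `(1 + x) (1 +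
y)`, which the normalization removes. -/
theorem psi_psi {j : ℕ} (hj : j + 1 < n) {a b : ℤ} (h0 : a ≠ b) (h1 : b ≠ a + 1)
    (h2 : b ≠ a - 1) (w : M) : psi q s j b a (psi q s j a b w) = w := by
  have e1 := one_add_alpha_ne_zero hq (show b - a ≠ 0 by omega) (by omega)
  have e2 := one_add_alpha_ne_zero hq (show a - b ≠ 0 by omega) (by omega)
  have e3 := alpha_neg hq (show b - a ≠ 0 by omega)
  rw [neg_sub] at e3
  have e4 := LinearMap.congr_fun (h.quad j hj) w
  simp only [LinearMap.add_apply, Module.End.mul_apply, LinearMap.smul_apply,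
    Module.End.one_apply] at e4
  simp only [psi_apply, map_sub, map_smul, e4]
  rw [e3] at e2 ⊢
  generalize alpha q (b - a) = x at *
  have : ∀ v : M, v = ((1 + x)⁻¹ * (1 + (q - 1 - x))⁻¹) • ((1 + x) * (1 + (q - 1 - x))) • v := by
    intro v
    rw [smul_smul, show (1 + x)⁻¹ * (1 + (q - 1 - x))⁻¹ * ((1 + x) * (1 + (q - 1 - x))) = 1 by
      field_simp, one_smul]
  conv_rhs => rw [this w]
  module

omit hq in
theorem psi_comm {i j : ℕ} (hij : i + 2 ≤ j) (hj : j + 1 < n) (a b c d : ℤ) (w : M) :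
    psi q s i a b (psi q s j c d w) = psi q s j c d (psi q s i a b w) := by
  have := LinearMap.congr_fun (h.comm i j hij hj).eq w
  simp only [Module.End.mul_apply] at this
  simp only [psi_apply, map_sub, map_smul, this]
  module

/-- A Yang–Baxter equation: the contents are mere spectral parameters, so `w` need not be an
eigenvector. Apart from the Hecke relations only `alpha_triangle` is needed. -/
theorem psi_braid {j : ℕ} (hj : j + 2 < n) {a b c : ℤ} (hab : a ≠ b) (hac : a ≠ c)
    (hbc : b ≠ c) (w : M) :
    psi q s j b c (psi q s (j + 1) a c (psi q s j a b w)) =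
      psi q s (j + 1) a b (psi q s j a c (psi q s (j + 1) b c w)) := by
  have e1 := alpha_triangle hq (show b - a ≠ 0 by omega) (show c - b ≠ 0 by omega) (by omega)
  rw [show b - a + (c - b) = c - a by ring] at e1
  have e2 := LinearMap.congr_fun (h.braid j hj) w
  have e3 := LinearMap.congr_fun (h.quad j (by omega)) w
  have e4 := LinearMap.congr_fun (h.quad (j + 1) (by omega)) w
  simp only [LinearMap.add_apply, Module.End.mul_apply, LinearMap.smul_apply,
    Module.End.one_apply] at e2 e3 e4
  simp only [psi_apply, map_sub, map_smul, e2, e3, e4]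
  generalize (1 + alpha q (b - a))⁻¹ = u
  generalize (1 + alpha q (c - a))⁻¹ = v
  generalize (1 + alpha q (c - b))⁻¹ = t
  generalize alpha q (b - a) = x at *
  generalize alpha q (c - a) = y at *
  generalize alpha q (c - b) = z at *
  generalize s (j + 1) (s j (s (j + 1) w)) = w121
  generalize s j (s (j + 1) w) = w12
  generalize s (j + 1) (s j w) = w21
  generalize s j w = w1
  generalize s (j + 1) w = w2
  match_scalars <;>
    first
    | ring1
    | linear_combination (u * v * t) * e1
    | linear_combination -(u * v * t) * e1

/-- The normalized intertwiner on a joint eigenvector. -/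
theorem psi_mem_wt {j : ℕ} (hj : j + 1 < n) {c : ℕ → ℤ} (hc : c j ≠ c (j + 1)) {w : M}
    (hw : w ∈ wt q s n c) : psi q s j (c j) (c (j + 1)) w ∈ wt q s n (swapC c j) := by
  have h1 := phi_mem_wt h hq le_rfl hj hw
  rw [phi_apply hq hc (hw j (by omega)) (hw (j + 1) hj),
    Submodule.smul_mem_iff _ (sub_ne_zero.mpr (hq.jval_injective.ne hc))] at h1
  rw [psi_apply]
  exact Submodule.smul_mem _ _ h1

/-- Exchanging neighbours that cannot be exchanged acts by a scalar. -/
theorem s_apply_of_le {T : ℕ → ℕ × ℕ} (hT : IsStd n T) {j : ℕ} (hj : j + 1 < n)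
    (hle : T j ≤ T (j + 1)) {w : M} (hw : w ∈ wt q s n fun i => ct (T i)) :
    s j w = alpha q (ct (T (j + 1)) - ct (T j)) • w := by
  have hc := hT.ct_ne hj
  -- The two boxes are neighbours, so their contents differ by one; a nonzero image would produce
  -- two addable boxes at that distance.
  have h1 : phi q s j w = 0 := by
    by_contra hp
    obtain ⟨T', hT', hTc'⟩ := (weights_of_le h hq n le_rfl).2 _ _ hp (phi_mem_wt h hq le_rfl hj hw)
    have hlow := (hT.mono (show j ≤ n by omega)).eq_of_ct_eq (hT'.mono (by omega))
      (fun a ha => by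
        rw [hTc' a (by omega), swapC, Equiv.swap_apply_of_ne_of_ne (by omega) (by omega)])
    have e2 := hTc' j (by omega)
    rw [swapC, Equiv.swap_apply_left] at e2
    have := IsStd.two_le_of_ne (hT.mono (show j + 1 ≤ n by omega)) (hT'.mono (by omega)) hlow
      (fun e => by rw [e] at hc; exact hc e2)
    have := hT.ct_of_le hj hle
    omega
  rwa [phi_apply hq hc (hw j (by omega)) (hw (j + 1) hj), smul_eq_zero,
    or_iff_right (sub_ne_zero.mpr (hq.jval_injective.ne hc)), sub_eq_zero] at h1

omit h hq

theorem sum_swapAt (f : ℕ → ℕ × ℕ → ℕ) (T : ℕ → ℕ × ℕ) {j : ℕ} (hj : j + 1 < n) :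
    ∃ r, ∑ i ∈ Finset.range n, f i (T i) = r + f j (T j) + f (j + 1) (T (j + 1)) ∧
      ∑ i ∈ Finset.range n, f i (swapAt T j i) = r + f j (T (j + 1)) + f (j + 1) (T j) := by
  have h1 : j ∈ Finset.range n := Finset.mem_range.mpr (by omega)
  have h2 : j + 1 ∈ (Finset.range n).erase j :=
    Finset.mem_erase.mpr ⟨by omega, Finset.mem_range.mpr hj⟩
  refine ⟨∑ i ∈ ((Finset.range n).erase j).erase (j + 1), f i (T i), ?_, ?_⟩
  · rw [← Finset.add_sum_erase _ _ h1, ← Finset.add_sum_erase _ _ h2]; ring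
  · rw [← Finset.add_sum_erase _ _ h1, ← Finset.add_sum_erase _ _ h2, swapAt_left, swapAt_right,
      Finset.sum_congr rfl fun i hi => ?_]
    · ring
    · simp only [Finset.mem_erase] at hi
      rw [swapAt_of_ne T hi.2.1 hi.1]

/-- A measure of the disorder of `T` with respect to the ordering `pos` of the boxes. -/
def disorder (n : ℕ) (pos : ℕ × ℕ → ℕ) (T : ℕ → ℕ × ℕ) : ℕ :=
  ∑ i ∈ Finset.range n, (n - i) * pos (T i)

theorem disorder_swapAt_lt {pos : ℕ × ℕ → ℕ} {T : ℕ → ℕ × ℕ} {j : ℕ} (hj : j + 1 < n)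
    (hd : pos (T (j + 1)) < pos (T j)) : disorder n pos (swapAt T j) < disorder n pos T := by
  obtain ⟨r, h1, h2⟩ := sum_swapAt (fun i x => (n - i) * pos x) T hj
  rw [disorder, disorder, h1, h2]
  obtain ⟨k, rfl⟩ : ∃ k, n = j + 1 + k := ⟨n - (j + 1), by omega⟩
  rw [show j + 1 + k - j = k + 1 by omega, show j + 1 + k - (j + 1) = k by omega, add_mul,
    add_mul]
  omega

open Classical in
/-- The joint eigenvector of the tableau `T` obtained from `w₀` by normalized intertwiners that
sort the boxes according to `pos`. -/
def sortedVec (q : ℂ) (s : ℕ → Module.End ℂ M) (n : ℕ) (pos : ℕ × ℕ → ℕ) (w₀ : M)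
    (T : ℕ → ℕ × ℕ) : M :=
  if hd : ∃ j, j + 1 < n ∧ pos (T (j + 1)) < pos (T j) then
    psi q s hd.choose (ct (T (hd.choose + 1))) (ct (T hd.choose))
      (sortedVec q s n pos w₀ (swapAt T hd.choose))
  else w₀
termination_by disorder n pos T
decreasing_by exact disorder_swapAt_lt hd.choose_spec.1 hd.choose_spec.2

/-- Without descents the positions increase strictly, and a strictly increasing self-map of `{0, …,
n - 1}` is the identity. -/
theorem eq_of_sorted {T₀ T : ℕ → ℕ × ℕ} {pos : ℕ × ℕ → ℕ} (hpos : ∀ i < n, pos (T₀ i) = i)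
    (hT : IsStd n T) (him : T '' Set.Iio n = T₀ '' Set.Iio n)
    (hs : ¬ ∃ j, j + 1 < n ∧ pos (T (j + 1)) < pos (T j)) : ∀ i < n, T i = T₀ i := by
  push Not at hs
  have hT₀ : ∀ i < n, pos (T i) < n ∧ T₀ (pos (T i)) = T i := by
    intro i hi
    obtain ⟨a, ha, hae⟩ : T i ∈ T₀ '' Set.Iio n := him ▸ ⟨i, hi, rfl⟩
    rw [← hae, hpos a ha]
    exact ⟨ha, rfl⟩
  have hlt : ∀ j, j + 1 < n → pos (T j) < pos (T (j + 1)) := by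
    intro j hj
    refine lt_of_le_of_ne (hs j hj) fun e => ?_
    have h1 := (hT₀ j (by omega)).2
    rw [e, (hT₀ (j + 1) hj).2] at h1
    have := hT.inj _ hj _ (by omega) h1
    omega
  have hstep : ∀ d i, i + d < n → pos (T i) + d ≤ pos (T (i + d)) := by
    intro d
    induction d with
    | zero => intro i _; exact le_rfl
    | succ d ih =>
      intro i hi
      have h1 := ih i (by omega)
      have h2 := hlt (i + d) (by omega)
      rw [show i + (d + 1) = i + d + 1 by ring]
      omega
  intro i hi
  have h1 := hstep i 0 (by omega)
  rw [zero_add] at h1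
  have h2 := hstep (n - 1 - i) i (by omega)
  have h3 := (hT₀ (i + (n - 1 - i)) (by omega)).1
  rw [← (hT₀ i hi).2, show pos (T i) = i by omega]

theorem swapAt_comm (T : ℕ → ℕ × ℕ) {i j : ℕ} (hij : i + 2 ≤ j) :
    swapAt (swapAt T i) j = swapAt (swapAt T j) i := by
  funext a
  simp only [swapAt, Equiv.swap_apply_def]
  split_ifs <;> first | rfl | omega

theorem swapAt_braid (T : ℕ → ℕ × ℕ) (j : ℕ) :
    swapAt (swapAt (swapAt T j) (j + 1)) j = swapAt (swapAt (swapAt T (j + 1)) j) (j + 1) := by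
  funext a
  simp only [swapAt, Equiv.swap_apply_def]
  split_ifs <;> first | rfl | omega

include h hq

/-- The definition sorts along an arbitrarily chosen descent; the point is that every descent gives
the same vector. By induction on the disorder, distant descents are reconciled by `psi_comm` and
adjacent ones by `psi_braid`. -/
theorem sortedVec_spec {T₀ : ℕ → ℕ × ℕ} {pos : ℕ × ℕ → ℕ} (hpos : ∀ i < n, pos (T₀ i) = i)
    (hT₀ : IsStd n T₀) {w₀ : M} (hw₀ : w₀ ≠ 0) (hw : w₀ ∈ wt q s n fun i => ct (T₀ i)) :
    ∀ (d : ℕ) (T : ℕ → ℕ × ℕ), disorder n pos T = d → IsStd n T →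
      T '' Set.Iio n = T₀ '' Set.Iio n →
      (sortedVec q s n pos w₀ T ∈ (wt q s n fun i => ct (T i)) ∧ sortedVec q s n pos w₀ T ≠ 0) ∧
      ∀ j, j + 1 < n → pos (T (j + 1)) < pos (T j) → sortedVec q s n pos w₀ T =
        psi q s j (ct (T (j + 1))) (ct (T j)) (sortedVec q s n pos w₀ (swapAt T j)) := by
  -- `pos` is the order of entries in the standard tableau `T₀`, so it is compatible with the order
  -- of boxes.
  have hdesc : ∀ T : ℕ → ℕ × ℕ, T '' Set.Iio n = T₀ '' Set.Iio n → ∀ a b, a < n → b < n →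
      pos (T b) < pos (T a) → ¬ T a ≤ T b := by
    intro T him a b ha hb hlt hle
    obtain ⟨a', ha', hae⟩ : T a ∈ T₀ '' Set.Iio n := him ▸ ⟨a, ha, rfl⟩
    obtain ⟨b', hb', hbe⟩ : T b ∈ T₀ '' Set.Iio n := him ▸ ⟨b, hb, rfl⟩
    rw [← hae, ← hbe] at hle hlt
    rw [hpos _ ha', hpos _ hb'] at hlt
    have := hT₀.le_of_le ha' hb' hle
    omega
  intro d
  induction d using Nat.strong_induction_on with
  | _ d ih =>
    intro T hd hT him
    have ih' : ∀ j, j + 1 < n → pos (T (j + 1)) < pos (T j) → _ := fun j hj hlt =>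
      ih _ (hd ▸ disorder_swapAt_lt hj hlt) (swapAt T j) rfl
        (hT.swapAt hj (hdesc T him _ _ (by omega) hj hlt)) (by rw [image_swapAt T hj, him])
    -- Three decreasing positions can be sorted in two ways; after three exchanges both reach the
    -- same tableau by `swapAt_braid`.
    have hbr : ∀ i, i + 2 < n → pos (T (i + 1)) < pos (T i) → pos (T (i + 2)) < pos (T (i + 1)) →
        psi q s i (ct (T (i + 1))) (ct (T i)) (sortedVec q s n pos w₀ (swapAt T i)) =
        psi q s (i + 1) (ct (T (i + 2))) (ct (T (i + 1)))
          (sortedVec q s n pos w₀ (swapAt T (i + 1))) := by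
      intro i hi h1 h2
      have e3 : swapAt T i (i + 2) = T (i + 2) := swapAt_of_ne T (by omega) (by omega)
      have e4 : swapAt T (i + 1) i = T i := swapAt_of_ne T (by omega) (by omega)
      have e5 : swapAt T (i + 1) (i + 2) = T (i + 1) := swapAt_right T (i + 1)
      have hT1 := hT.swapAt (show i + 1 < n by omega) (hdesc T him _ _ (by omega) (by omega) h1)
      have hT2 := hT.swapAt (show i + 1 + 1 < n by omega)
        (hdesc T him _ _ (by omega) (by omega) h2)
      have g1 := (ih' i (by omega) h1).2 (i + 1) hi (by
        rw [swapAt_right, show i + 1 + 1 = i + 2 from rfl, e3]; omega)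
      have g2 := (ih' (i + 1) hi h2).2 i (by omega) (by
        rw [swapAt_left, e4]; exact h2.trans h1)
      have him1 : swapAt T i '' Set.Iio n = T₀ '' Set.Iio n := by
        rw [image_swapAt T (by omega), him]
      have him2 : swapAt T (i + 1) '' Set.Iio n = T₀ '' Set.Iio n := by
        rw [image_swapAt T (by omega), him]
      have c1 := hT.two_le_of_not_le (show i + 1 < n by omega)
        (hdesc T him _ _ (by omega) (by omega) h1)
      have c2 := hT.two_le_of_not_le (show i + 1 + 1 < n by omega)
        (hdesc T him _ _ (by omega) (by omega) h2)
      rw [show i + 1 + 1 = i + 2 from rfl] at c2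
      have hx : ¬ swapAt T i (i + 1) ≤ swapAt T i (i + 1 + 1) := by
        rw [swapAt_right, show i + 1 + 1 = i + 2 from rfl, e3]
        exact hdesc T him _ _ (by omega) (by omega) (h2.trans h1)
      have hy : ¬ swapAt T (i + 1) i ≤ swapAt T (i + 1) (i + 1) := by
        rw [swapAt_left, e4]
        exact hdesc T him _ _ (by omega) (by omega) (h2.trans h1)
      have c3 := hT1.two_le_of_not_le hi hx
      rw [swapAt_right, show i + 1 + 1 = i + 2 from rfl, e3] at c3 g1
      rw [swapAt_left, show i + 1 + 1 = i + 2 from rfl, e4] at g2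
      have l1 : disorder n pos (swapAt (swapAt T i) (i + 1)) < d := by
        refine (disorder_swapAt_lt hi ?_).trans (hd ▸ disorder_swapAt_lt (by omega) h1)
        rw [swapAt_right, show i + 1 + 1 = i + 2 from rfl, e3]; exact h2.trans h1
      have l2 : disorder n pos (swapAt (swapAt T (i + 1)) i) < d := by
        refine (disorder_swapAt_lt (by omega) ?_).trans (hd ▸ disorder_swapAt_lt hi h2)
        rw [swapAt_left, show i + 1 + 1 = i + 2 from rfl, e4]; exact h2.trans h1
      have m1 : swapAt (swapAt T i) (i + 1) i = T (i + 1) := by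
        rw [swapAt_of_ne _ (by omega) (by omega), swapAt_left]
      have m2 : swapAt (swapAt T i) (i + 1) (i + 1) = T (i + 2) := by
        rw [swapAt_left, show i + 1 + 1 = i + 2 from rfl, e3]
      have m3 : swapAt (swapAt T (i + 1)) i (i + 1) = T i := by
        rw [swapAt_right, e4]
      have m4 : swapAt (swapAt T (i + 1)) i (i + 2) = T (i + 1) := by
        rw [swapAt_of_ne _ (by omega) (by omega), e5]
      have k1 := (ih _ l1 _ rfl (hT1.swapAt hi hx) (by rw [image_swapAt _ hi, him1])).2 i
        (by omega) (by rw [m1, m2]; exact h2)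
      have k2 := (ih _ l2 _ rfl (hT2.swapAt (by omega) hy)
        (by rw [image_swapAt _ (by omega), him2])).2 (i + 1) hi
        (by rw [show i + 1 + 1 = i + 2 from rfl, m3, m4]; exact h1)
      rw [m1, m2] at k1
      rw [show i + 1 + 1 = i + 2 from rfl, m3, m4] at k2
      rw [g1, g2, k1, k2, swapAt_braid]
      exact psi_braid h hq hi (by omega) (by omega) (by omega) _
    have hcm : ∀ i j, i + 2 ≤ j → j + 1 < n → pos (T (i + 1)) < pos (T i) →
        pos (T (j + 1)) < pos (T j) →
        psi q s i (ct (T (i + 1))) (ct (T i)) (sortedVec q s n pos w₀ (swapAt T i)) =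
        psi q s j (ct (T (j + 1))) (ct (T j)) (sortedVec q s n pos w₀ (swapAt T j)) := by
      intro i j hij hj h1 h2
      have e1 : swapAt T i j = T j := swapAt_of_ne T (by omega) (by omega)
      have e2 : swapAt T i (j + 1) = T (j + 1) := swapAt_of_ne T (by omega) (by omega)
      have e3 : swapAt T j i = T i := swapAt_of_ne T (by omega) (by omega)
      have e4 : swapAt T j (i + 1) = T (i + 1) := swapAt_of_ne T (by omega) (by omega)
      rw [(ih' i (by omega) h1).2 j hj (by rw [e1, e2]; exact h2),
        (ih' j hj h2).2 i (by omega) (by rw [e3, e4]; exact h1), e1, e2, e3, e4,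
        swapAt_comm T hij, psi_comm h hij hj]
    have hall : ∀ i j, i + 1 < n → j + 1 < n → pos (T (i + 1)) < pos (T i) →
        pos (T (j + 1)) < pos (T j) →
        psi q s i (ct (T (i + 1))) (ct (T i)) (sortedVec q s n pos w₀ (swapAt T i)) =
        psi q s j (ct (T (j + 1))) (ct (T j)) (sortedVec q s n pos w₀ (swapAt T j)) := by
      intro i j hi hj h1 h2
      rcases lt_trichotomy i j with hij | rfl | hij
      · rcases (Nat.succ_le_of_lt hij).eq_or_lt with rfl | hij
        · exact hbr i hj h1 h2
        · exact hcm i j hij hj h1 h2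
      · rfl
      · rcases (Nat.succ_le_of_lt hij).eq_or_lt with rfl | hij
        · exact (hbr j hi h2 h1).symm
        · exact (hcm j i hij hi h2 h1).symm
    by_cases hs : ∃ j, j + 1 < n ∧ pos (T (j + 1)) < pos (T j)
    · have hj := hs.choose_spec
      have e : sortedVec q s n pos w₀ T = psi q s hs.choose (ct (T (hs.choose + 1)))
          (ct (T hs.choose)) (sortedVec q s n pos w₀ (swapAt T hs.choose)) := by
        rw [sortedVec, dif_pos hs]
      generalize hs.choose = j₀ at *
      refine ⟨?_, fun j hj' hlt => by rw [e]; exact hall _ _ hj.1 hj' hj.2 hlt⟩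
      obtain ⟨⟨i1, i2⟩, -⟩ := ih' j₀ hj.1 hj.2
      have c1 := hT.two_le_of_not_le hj.1 (hdesc T him _ _ (by omega) hj.1 hj.2)
      rw [e]
      refine ⟨?_, fun h0 => i2 ?_⟩
      · have h1 := psi_mem_wt h hq hj.1 (c := fun i => ct (swapAt T j₀ i))
          (by simp only [swapAt_left, swapAt_right]; omega) i1
        simp only [swapAt_left, swapAt_right] at h1
        exact wt_congr (fun i _ => by simp [swapC, swapAt]) h1
      · have := psi_psi h hq hj.1 (a := ct (T (j₀ + 1))) (b := ct (T j₀)) (by omega) (by omega)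
          (by omega) (sortedVec q s n pos w₀ (swapAt T j₀))
        rw [h0, map_zero] at this
        exact this.symm
    · have e : sortedVec q s n pos w₀ T = w₀ := by rw [sortedVec, dif_neg hs]
      have heq := eq_of_sorted hpos hT him hs
      rw [e]
      refine ⟨⟨wt_congr (fun i hi => by rw [heq i hi]) hw, hw₀⟩, fun j hj hlt => ?_⟩
      exact (hs ⟨j, hj, hlt⟩).elim

/-- A joint eigenvector of the Jucys–Murphy operators generates a copy of Young's seminormal
basis. -/
theorem exists_seminormal_family {T₀ : ℕ → ℕ × ℕ} (hT₀ : IsStd n T₀) {w₀ : M} (hw₀ : w₀ ≠ 0)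
    (hw : w₀ ∈ wt q s n fun i => ct (T₀ i)) :
    ∃ w : (ℕ → ℕ × ℕ) → M, ∀ T, IsStd n T → T '' Set.Iio n = T₀ '' Set.Iio n →
      w T ∈ (wt q s n fun i => ct (T i)) ∧ w T ≠ 0 ∧
      ∀ j, j + 1 < n → ¬ T j ≤ T (j + 1) →
        psi q s j (ct (T j)) (ct (T (j + 1))) (w T) = w (swapAt T j) := by
  have hinj : Set.InjOn T₀ (Set.Iio n) := fun a ha b hb hab => hT₀.inj a ha b hb hab
  set pos := Function.invFunOn T₀ (Set.Iio n)
  have hpos : ∀ i < n, pos (T₀ i) = i := fun i hi => hinj.leftInvOn_invFunOn hi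
  have key := sortedVec_spec h hq hpos hT₀ hw₀ hw
  refine ⟨sortedVec q s n pos w₀, fun T hT him => ?_⟩
  obtain ⟨⟨h1, h2⟩, h3⟩ := key _ T rfl hT him
  refine ⟨h1, h2, fun j hj hle => ?_⟩
  have c1 := hT.two_le_of_not_le hj hle
  -- At a descent invert the intertwiner; at an ascent the exchanged tableau has a descent, to which
  -- the recursion applies.
  rcases lt_trichotomy (pos (T (j + 1))) (pos (T j)) with hlt | heq | hlt
  · rw [h3 j hj hlt, psi_psi h hq hj (by omega) (by omega) (by omega)]
  · obtain ⟨a, ha, hae⟩ : T j ∈ T₀ '' Set.Iio n := him ▸ ⟨j, show j < n by omega, rfl⟩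
    obtain ⟨b, hb, hbe⟩ : T (j + 1) ∈ T₀ '' Set.Iio n := him ▸ ⟨j + 1, hj, rfl⟩
    rw [← hae, ← hbe, hpos a ha, hpos b hb] at heq
    rw [heq, hae] at hbe
    have := hT.inj _ (by omega) _ hj hbe
    omega
  · have := (key _ (swapAt T j) rfl (hT.swapAt hj hle) (by rw [image_swapAt T hj, him])).2 j hj
      (by rw [swapAt_left, swapAt_right]; exact hlt)
    rw [swapAt_left, swapAt_right, swapAt_swapAt] at this
    exact this.symm

end Family

/-! ### Murphy operators as Jucys–Murphy elements -/

section Gen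

variable {n : ℕ} {q : ℂ}

theorem gen_eq {k : ℕ} (hk : 1 ≤ k) (hk' : k ≤ n - 1) :
    gen n q k = RingQuot.mkAlgHom ℂ (HeckeRel n q) (FreeAlgebra.ι ℂ ⟨k - 1, by omega⟩) :=
  dif_pos ⟨hk, hk'⟩

variable (n q)

theorem heckeRelations_gen : HeckeRelations n q fun j => gen n q (j + 1) := by
  refine ⟨fun j hj => ?_, fun j hj => ?_, fun i j hij hj => ?_⟩
  · have := RingQuot.mkAlgHom_rel ℂ (HeckeRel.quad (q := q) (⟨j, by omega⟩ : Fin (n - 1)))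
    rw [map_mul, map_add, map_smul, AlgHom.commutes, Algebra.algebraMap_eq_smul_one] at this
    simpa only [gen_eq (n := n) (q := q) (k := j + 1) (by omega) (by omega),
      Nat.add_sub_cancel] using this
  · have := RingQuot.mkAlgHom_rel ℂ
      (HeckeRel.braid (q := q) (⟨j, by omega⟩ : Fin (n - 1)) ⟨j + 1, by omega⟩ rfl)
    simp only [map_mul] at this
    simpa only [gen_eq (n := n) (q := q) (k := j + 1) (by omega) (by omega),
      gen_eq (n := n) (q := q) (k := j + 1 + 1) (by omega) (by omega),
      Nat.add_sub_cancel] using this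
  · have := RingQuot.mkAlgHom_rel ℂ
      (HeckeRel.comm (q := q) (⟨i, by omega⟩ : Fin (n - 1)) ⟨j, by omega⟩ hij)
    simp only [map_mul] at this
    simpa only [Commute, SemiconjBy, gen_eq (n := n) (q := q) (k := i + 1) (by omega) (by omega),
      gen_eq (n := n) (q := q) (k := j + 1) (by omega) (by omega),
      Nat.add_sub_cancel] using this

variable {n q}

theorem HeckeRelations.map {A B : Type*} [Ring A] [Algebra ℂ A] [Ring B] [Algebra ℂ B]
    {s : ℕ → A} (h : HeckeRelations n q s) (f : A →ₐ[ℂ] B) :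
    HeckeRelations n q fun j => f (s j) := by
  refine ⟨fun j hj => ?_, fun j hj => ?_, fun i j hij hj => (h.comm i j hij hj).map f⟩
  · have := congrArg f (h.quad j hj)
    simpa using this
  · have := congrArg f (h.braid j hj)
    simpa using this

theorem map_jm {A B : Type*} [Ring A] [Algebra ℂ A] [Ring B] [Algebra ℂ B] (s : ℕ → A)
    (f : A →ₐ[ℂ] B) (j : ℕ) : f (jm q s j) = jm q (fun j => f (s j)) j := by
  induction j with
  | zero => exact map_zero f
  | succ j ih => rw [jm_succ, jm_succ, map_add, map_smul, map_mul, map_mul, ih]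

/-- The word is defined with its largest index in the middle; braid relations put that index on the
outside, as the recursion of `jm` requires. -/
theorem palindrome_succ_succ {m k : ℕ} (hk : k + 1 ≤ m) (hm : m + 1 < n) :
    palindrome n q (m + 1) (k + 1) =
      gen n q (m + 1) * palindrome n q m k * gen n q (m + 1) := by
  have h := heckeRelations_gen n q
  induction k with
  | zero =>
    obtain ⟨i, rfl⟩ : ∃ i, m = i + 1 := ⟨m - 1, by omega⟩
    exact h.braid i hm
  | succ k ih =>
    have h1 : Commute (gen n q (m - (k + 1))) (gen n q (m + 1)) := by
      have := h.comm (m - (k + 2)) m (by omega) hm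
      rwa [show m - (k + 2) + 1 = m - (k + 1) by omega] at this
    rw [palindrome, ih (by omega), palindrome, show m + 1 - (k + 1 + 1) = m - (k + 1) by omega]
    simp only [← mul_assoc, h1.eq]
    simp only [mul_assoc, h1.eq]

/-- The term `k = 0` is the new generator, and the others are conjugates by it of the terms one
level lower. Positions count from `0`, hence the shift of indices. -/
theorem murphy_one {j : ℕ} (hj : j < n) :
    murphy n q 1 (j + 1) = jm q (fun j => gen n q (j + 1)) j := by
  induction j with
  | zero => simp [murphy, jm]
  | succ j ih =>
    rw [jm_succ, ← ih (by omega), murphy, murphy, show j + 1 + 1 - 1 = j + 1 by omega,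
      show j + 1 - 1 = j by omega, show j + 1 + 1 + 1 - 2 = j + 1 by omega,
      show j + 1 + 1 - 2 = j by omega, Finset.sum_range_succ', add_comm]
    congr 1
    · simp [palindrome]
    · rw [Finset.mul_sum, Finset.sum_mul, Finset.smul_sum]
      refine Finset.sum_congr rfl fun k hk => ?_
      have hk := Finset.mem_range.mp hk
      rw [palindrome_succ_succ (by omega) hj, mul_smul_comm, smul_mul_assoc, smul_smul, pow_succ,
        mul_inv, mul_comm]

end Gen

/-! ### `Q` on joint eigenvectors -/

section Action

variable {n : ℕ} {q : ℂ} {M : Type*} [AddCommGroup M] [Module ℂ M]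
  (ρ : Hecke n q →ₐ[ℂ] Module.End ℂ M)

/-- The operators by which the generators act. -/
def genAct (j : ℕ) : Module.End ℂ M := ρ (gen n q (j + 1))

theorem heckeRelations_genAct : HeckeRelations n q (genAct ρ) :=
  (heckeRelations_gen n q).map ρ

variable {ρ}

theorem map_murphy_apply {c : ℕ → ℤ} {w : M} (hw : w ∈ wt q (genAct ρ) n c) {j : ℕ} (hj : 1 ≤ j)
    (hj' : j ≤ n) : ρ (murphy n q 1 j) w = jval q (c (j - 1)) • w := by
  obtain ⟨j, rfl⟩ : ∃ i, j = i + 1 := ⟨j - 1, by omega⟩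
  rw [murphy_one (by omega), map_jm]
  exact hw j (by omega)

theorem map_murphyProd_apply {c : ℕ → ℤ} {w : M} (hw : w ∈ wt q (genAct ρ) n c) {N : ℕ}
    (hN : 1 ≤ N) (hNn : N ≤ n) (x : ℂ) :
    ρ (murphyProd n q 1 N x) w = (∏ j ∈ Finset.Ico 1 N, (jval q (c j) - x)) • w := by
  have key : ∀ l : List ℕ, (∀ j ∈ l, 1 ≤ j ∧ j ≤ n) →
      ρ ((l.map fun j => murphy n q 1 j - algebraMap ℂ (Hecke n q) x).prod) w =
        (l.map fun j => jval q (c (j - 1)) - x).prod • w := by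
    intro l
    induction l with
    | nil => simp
    | cons j l ih =>
      intro hl
      have h1 := hl j List.mem_cons_self
      rw [List.map_cons, List.prod_cons, List.map_cons, List.prod_cons, map_mul,
        Module.End.mul_apply, ih fun i hi => hl i (List.mem_cons_of_mem _ hi), map_smul, map_sub,
        LinearMap.sub_apply, map_murphy_apply hw h1.1 h1.2, AlgHom.commutes,
        Module.algebraMap_end_apply, ← sub_smul, smul_smul, mul_comm]
  rw [murphyProd, key _ fun j hj => by rw [List.mem_range'_1] at hj; omega]
  congr 1
  have h1 : ∏ j ∈ Finset.Ico (1 + 1) (N + 1), (jval q (c (j - 1)) - x) =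
      ∏ j ∈ Finset.Ico 1 N, (jval q (c j) - x) := by
    rw [← Finset.prod_Ico_add']
    simp
  rw [← h1]
  obtain ⟨k, rfl⟩ : ∃ k, N = k + 1 := ⟨N - 1, by omega⟩
  rfl

variable {lh lv : ℕ} (hlh : 1 ≤ lh) (hlv : 1 ≤ lv)

theorem mem_rect {x : ℕ × ℕ} : x ∈ (rect lh lv).cells ↔ x.1 < lv ∧ x.2 < lh := by
  simp [rect]

theorem card_rect (lh lv : ℕ) : (rect lh lv).cells.card = lh * lv := by
  simp [rect, mul_comm]

theorem IsStd.zero {m : ℕ} {T : ℕ → ℕ × ℕ} (hT : IsStd m T) (hm : 0 < m) : T 0 = (0, 0) := by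
  obtain ⟨a, ha, hae⟩ := hT.lower 0 hm (0, 0) ⟨Nat.zero_le _, Nat.zero_le _⟩
  rwa [Nat.le_zero.mp ha] at hae

include hlh hlv

/-- The tableau enumerates the boxes of the rectangle; the omitted position `0` holds the corner box
`(1, 1)` of the denominator. -/
theorem rectDenom_eq {T : ℕ → ℕ × ℕ} (hT : IsStd (lh * lv) T)
    (him : T '' Set.Iio (lh * lv) = (rect lh lv).cells) (x : ℂ) :
    ∏ j ∈ Finset.Ico 1 (lh * lv), (jval q (ct (T j)) - x) = rectDenom q lh lv x := by
  have hN : 0 < lh * lv := Nat.mul_pos hlh hlv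
  refine Finset.prod_nbij (fun j => ((T j).2 + 1, (T j).1 + 1)) ?_ ?_ ?_ ?_
  · intro j hj
    have hj := Finset.mem_Ico.mp hj
    have h1 : T j ∈ ((rect lh lv).cells : Set (ℕ × ℕ)) := him ▸ ⟨j, hj.2, rfl⟩
    have h2 := mem_rect.mp h1
    have h3 : T j ≠ (0, 0) := fun e => by
      have := hT.inj j hj.2 0 hN (by rw [e, hT.zero hN])
      omega
    simp only [Finset.mem_erase, Finset.mem_product, Finset.mem_Icc, ne_eq, Prod.mk.injEq]
    refine ⟨fun e => h3 (Prod.ext (by simp only; omega) (by simp only; omega)), by omega⟩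
  · intro i hi j hj hij
    have hi := Finset.mem_Ico.mp hi
    have hj := Finset.mem_Ico.mp hj
    simp only [Prod.mk.injEq, Nat.add_right_cancel_iff] at hij
    exact hT.inj i hi.2 j hj.2 (Prod.ext hij.2 hij.1)
  · rintro ⟨a, b⟩ hp
    simp only [Finset.coe_erase, Set.mem_sdiff, Finset.mem_coe, Finset.mem_product, Finset.mem_Icc,
      Set.mem_singleton_iff, Prod.mk.injEq] at hp
    have h1 : (b - 1, a - 1) ∈ ((rect lh lv).cells : Set (ℕ × ℕ)) := by
      rw [Finset.mem_coe, mem_rect]; simp only; omega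
    rw [← him] at h1
    obtain ⟨j, hj, hje⟩ := h1
    refine ⟨j, ?_, ?_⟩
    · rw [Finset.mem_coe, Finset.mem_Ico]
      refine ⟨Nat.one_le_iff_ne_zero.mpr ?_, hj⟩
      rintro rfl
      rw [hT.zero hN, Prod.mk.injEq] at hje
      omega
    · simp only [hje, Prod.mk.injEq]; omega
  · intro j _
    simp only [jval, ct]
    congr 3
    push_cast
    ring

omit hlh hlv in
-- Contents in the rectangle lie strictly between `-lv` and `lh`.
theorem rectDenom_ne_zero (hq : QGeneric q) {k : ℤ} (hk : k = lh ∨ k = -lv) :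
    rectDenom q lh lv (q * qNum q k) ≠ 0 := by
  refine Finset.prod_ne_zero_iff.mpr fun p hp => sub_ne_zero.mpr ?_
  have hp := Finset.mem_product.mp (Finset.mem_of_mem_erase hp)
  rw [Finset.mem_Icc, Finset.mem_Icc] at hp
  exact hq.jval_injective.ne (a₁ := (p.1 : ℤ) - p.2) (a₂ := k) (by omega)

omit hlh hlv in
-- A shape of the same size that misses the boxes `(lv, 0)` and `(0, lh)` lies inside the rectangle,
-- hence equals it.
theorem exists_ct_of_ne {T : ℕ → ℕ × ℕ} (hT : IsStd (lh * lv) T)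
    (him : T '' Set.Iio (lh * lv) ≠ (rect lh lv).cells) :
    ∃ j < lh * lv, ct (T j) = lh ∨ ct (T j) = -lv := by
  classical
  by_contra hcon
  push Not at hcon
  apply him
  have h1 : (Finset.range (lh * lv)).image T = (rect lh lv).cells := by
    refine Finset.eq_of_subset_of_card_le (fun x hx => ?_) ?_
    · obtain ⟨j, hj, rfl⟩ := Finset.mem_image.mp hx
      have hj := Finset.mem_range.mp hj
      rw [mem_rect]
      constructor
      · by_contra hlt
        obtain ⟨a, ha, hae⟩ := hT.lower j hj (lv, 0) ⟨by simpa using hlt, Nat.zero_le _⟩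
        exact (hcon a (by omega)).2 (by simp [hae, ct])
      · by_contra hlt
        obtain ⟨a, ha, hae⟩ := hT.lower j hj (0, lh) ⟨Nat.zero_le _, by simpa using hlt⟩
        exact (hcon a (by omega)).1 (by simp [hae, ct])
    · rw [card_rect, Finset.card_image_of_injOn fun a ha b hb hab =>
        hT.inj a (by simpa using ha) b (by simpa using hb) hab, Finset.card_range]
  rw [← h1]
  simp

theorem opQ_apply_of_eq (hq : QGeneric q) {T : ℕ → ℕ × ℕ} (hn : lh * lv ≤ n)
    (hT : IsStd (lh * lv) T) {w : M} (hw : w ∈ wt q (genAct ρ) n fun i => ct (T i))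
    (him : T '' Set.Iio (lh * lv) = (rect lh lv).cells) : ρ (opQ n q lh lv 1) w = w := by
  have hN : 1 ≤ lh * lv := Nat.mul_pos hlh hlv
  have h1 := rectDenom_ne_zero (lh := lh) (lv := lv) hq (k := lh) (Or.inl rfl)
  have h2 := rectDenom_ne_zero (lh := lh) (lv := lv) hq (k := -lv) (Or.inr rfl)
  rw [opQ, map_mul, Module.End.mul_apply, opC, map_smul, LinearMap.smul_apply,
    map_murphyProd_apply hw hN hn, rectDenom_eq hlh hlv hT him, smul_smul, inv_mul_cancel₀ h1,
    one_smul, opR, map_smul, LinearMap.smul_apply, map_murphyProd_apply hw hN hn,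
    rectDenom_eq hlh hlv hT him, smul_smul, inv_mul_cancel₀ h2, one_smul]

theorem opQ_apply_of_ne {T : ℕ → ℕ × ℕ} (hn : lh * lv ≤ n)
    (hT : IsStd (lh * lv) T) {w : M} (hw : w ∈ wt q (genAct ρ) n fun i => ct (T i))
    (him : T '' Set.Iio (lh * lv) ≠ (rect lh lv).cells) : ρ (opQ n q lh lv 1) w = 0 := by
  have hN : 1 ≤ lh * lv := Nat.mul_pos hlh hlv
  obtain ⟨j, hj, hjc⟩ := exists_ct_of_ne hT him
  -- The corner, which has no factor in the product, has content zero, so the vanishing factor is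
  -- really present.
  have hj0 : j ≠ 0 := by
    rintro rfl
    rw [hT.zero hj] at hjc
    simp only [ct] at hjc
    omega
  have hjm : j ∈ Finset.Ico 1 (lh * lv) := Finset.mem_Ico.mpr ⟨by omega, hj⟩
  rw [opQ, map_mul, Module.End.mul_apply, opC, map_smul, LinearMap.smul_apply,
    map_murphyProd_apply hw hN hn, opR, map_smul ρ, LinearMap.smul_apply, map_smul, map_smul,
    map_murphyProd_apply hw hN hn]
  rcases hjc with hjc | hjc
  · rw [Finset.prod_eq_zero (s := Finset.Ico 1 (lh * lv)) (f := fun j => jval q (ct (T j)) -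
      q * qNum q lh) hjm (by rw [hjc]; exact sub_self _)]
    simp
  · rw [Finset.prod_eq_zero (s := Finset.Ico 1 (lh * lv)) (f := fun j => jval q (ct (T j)) -
      q * qNum q (-lv)) hjm (by rw [hjc]; exact sub_self _)]
    simp

end Action

/-! ### Bundled tableaux and box sequences -/

namespace StandardTableau

variable {n : ℕ} {μ : YoungDiagram}

/-- The sequence of boxes of a standard tableau, continued by the corner box. -/
def seq (T : StandardTableau n μ) (i : ℕ) : ℕ × ℕ := if h : i < n then T.box ⟨i, h⟩ else (0, 0)

theorem seq_of_lt (T : StandardTableau n μ) {i : ℕ} (hi : i < n) : T.seq i = T.box ⟨i, hi⟩ :=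
  dif_pos hi

theorem seq_of_ge (T : StandardTableau n μ) {i : ℕ} (hi : n ≤ i) : T.seq i = (0, 0) :=
  dif_neg (by omega)

theorem image_seq (T : StandardTableau n μ) : T.seq '' Set.Iio n = (μ.cells : Set (ℕ × ℕ)) := by
  rw [← T.range_eq]
  ext x
  constructor
  · rintro ⟨i, hi, rfl⟩
    exact ⟨⟨i, hi⟩, (T.seq_of_lt hi).symm⟩
  · rintro ⟨i, rfl⟩
    exact ⟨i, i.2, T.seq_of_lt i.2⟩

theorem isStd (T : StandardTableau n μ) : IsStd n T.seq := by
  refine ⟨fun a ha b hb hab => ?_, fun b hb x hx => ?_⟩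
  · rw [T.seq_of_lt ha, T.seq_of_lt hb] at hab
    simpa using T.injective hab
  · have h1 : T.seq b ∈ (μ.cells : Set (ℕ × ℕ)) := T.image_seq ▸ ⟨b, hb, rfl⟩
    have h2 := μ.isLowerSet hx h1
    rw [← T.image_seq] at h2
    obtain ⟨a, ha, rfl⟩ := h2
    have ha : a < n := ha
    refine ⟨a, ?_, rfl⟩
    rw [T.seq_of_lt ha, T.seq_of_lt hb] at hx
    exact T.standard _ _ hx

theorem seq_injective : Function.Injective (seq : StandardTableau n μ → ℕ → ℕ × ℕ) := by
  intro T T' h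
  refine StandardTableau.ext (funext fun i => ?_)
  have := congrFun h i
  rwa [T.seq_of_lt i.2, T'.seq_of_lt i.2] at this

/-- The standard tableau given by a sequence of boxes. -/
def ofIsStd {T : ℕ → ℕ × ℕ} (hT : IsStd n T) (him : T '' Set.Iio n = μ.cells) :
    StandardTableau n μ where
  box i := T i
  injective a b hab := Fin.ext (hT.inj a a.2 b b.2 hab)
  range_eq := by
    rw [← him]
    ext x
    constructor
    · rintro ⟨i, rfl⟩
      exact ⟨i, i.2, rfl⟩
    · rintro ⟨i, hi, rfl⟩
      exact ⟨⟨i, hi⟩, rfl⟩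
  standard a b hab := hT.le_of_le a.2 b.2 hab

theorem seq_ofIsStd {T : ℕ → ℕ × ℕ} (hT : IsStd n T) (him : T '' Set.Iio n = μ.cells) {i : ℕ}
    (hi : i < n) : (ofIsStd hT him).seq i = T i := seq_of_lt _ hi

theorem diagCoeff_eq (q : ℂ) (T : StandardTableau n μ) (i : Fin (n - 1)) :
    T.diagCoeff q i = alpha q (ct (T.seq (i + 1)) - ct (T.seq i)) := by
  rw [T.seq_of_lt (show (i : ℕ) + 1 < n by omega), T.seq_of_lt (show (i : ℕ) < n by omega)]
  rfl

theorem swapVec_of_le (T : StandardTableau n μ) (i : Fin (n - 1))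
    (hle : T.seq i ≤ T.seq (i + 1)) : T.swapVec i = 0 := by
  refine dif_neg fun h => ?_
  rw [T.seq_of_lt (show (i : ℕ) + 1 < n by omega), T.seq_of_lt (show (i : ℕ) < n by omega)] at hle
  have := h (hi i) (lo i) (by rw [Equiv.swap_apply_left, Equiv.swap_apply_right]; exact hle)
  simp [hi, lo] at this

theorem exists_swapVec_of_not_le (T : StandardTableau n μ) (i : Fin (n - 1))
    (hle : ¬ T.seq i ≤ T.seq (i + 1)) :
    ∃ T' : StandardTableau n μ, T'.seq = swapAt T.seq i ∧ T.swapVec i = Finsupp.single T' 1 := by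
  have hi1 : (i : ℕ) + 1 < n := by omega
  have hext : ∀ a : Fin n, T.box (Equiv.swap (lo i) (hi i) a) = swapAt T.seq i a := by
    intro a
    by_cases h1 : (a : ℕ) = i
    · rw [show a = lo i from Fin.ext h1, Equiv.swap_apply_left]
      exact (T.seq_of_lt hi1).symm.trans (swapAt_left _ _).symm
    by_cases h2 : (a : ℕ) = i + 1
    · rw [show a = hi i from Fin.ext h2, Equiv.swap_apply_right]
      exact (T.seq_of_lt (show (i : ℕ) < n by omega)).symm.trans (swapAt_right _ _).symm
    · rw [swapAt_of_ne _ h1 h2, T.seq_of_lt a.2, Equiv.swap_apply_of_ne_of_ne]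
      · exact fun e => h1 (congrArg Fin.val e)
      · exact fun e => h2 (congrArg Fin.val e)
  have hstd : ∀ a b, T.box (Equiv.swap (lo i) (hi i) a) ≤ T.box (Equiv.swap (lo i) (hi i) b) →
      a ≤ b := by
    intro a b hab
    rw [hext, hext] at hab
    exact (T.isStd.swapAt hi1 hle).le_of_le a.2 b.2 hab
  refine ⟨_, ?_, dif_pos hstd⟩
  funext a
  by_cases ha : a < n
  · rw [seq_of_lt _ ha]
    exact hext ⟨a, ha⟩
  · rw [seq_of_ge _ (by omega), swapAt_of_ne _ (by omega) (by omega), seq_of_ge _ (by omega)]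

end StandardTableau

/-! ### `Q` on seminormal representations -/

section Diagram

variable {n : ℕ} {q : ℂ} {V : Type*} [AddCommGroup V] [Module ℂ V]
  {ρ : Hecke n q →ₐ[ℂ] Module.End ℂ V} {μ : YoungDiagram}

/-- The seminormal basis consists of joint eigenvectors of the Jucys–Murphy operators. -/
theorem exists_basis_of_hasDiagram (hq : QGeneric q) (hd : HasDiagram ρ μ) :
    ∃ b : Module.Basis (StandardTableau n μ) ℂ V,
      ∀ T, b T ∈ wt q (genAct ρ) n fun i => ct (T.seq i) := by
  obtain ⟨-, e, he⟩ := hd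
  set b := Module.Basis.ofRepr e
  have hb : ∀ T, e (b T) = Finsupp.single T 1 := fun T => b.repr_self T
  have hact : ∀ T j, ∀ hj : j + 1 < n,
      genAct ρ j (b T) = alpha q (ct (T.seq (j + 1)) - ct (T.seq j)) • b T +
        (1 + alpha q (ct (T.seq (j + 1)) - ct (T.seq j))) • e.symm (T.swapVec ⟨j, by omega⟩) := by
    intro T j hj
    have h1 := he ⟨j, by omega⟩ (b T)
    rw [hb, seminormal, Finsupp.linearCombination_single, one_smul,
      StandardTableau.diagCoeff_eq] at h1
    apply e.injective
    rw [map_add, map_smul, map_smul, LinearEquiv.apply_symm_apply, hb]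
    exact h1
  have h := heckeRelations_genAct ρ
  have key : ∀ j, j < n → ∀ T, jm q (genAct ρ) j (b T) = jval q (ct (T.seq j)) • b T := by
    intro j
    induction j with
    | zero =>
      intro hn T
      rw [T.isStd.zero hn]
      simp [jm, ct]
    | succ j ih =>
      intro hj T
      have hc := T.isStd.ct_ne hj
      have h0 := alpha_mul_jval_sub hq hc
      -- By induction the exchanged vector, or zero, has the eigenvalue of the next box. Applying
      -- the generator once more, the quadratic relation leaves exactly that eigenvalue for `jm` at
      -- `j + 1`.
      have hX : jm q (genAct ρ) j (genAct ρ j (b T)) = jval q (ct (T.seq (j + 1))) •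
          genAct ρ j (b T) - ((q - 1) * jval q (ct (T.seq (j + 1))) + q) • b T := by
        have h2 : jm q (genAct ρ) j (e.symm (T.swapVec ⟨j, by omega⟩)) =
            jval q (ct (T.seq (j + 1))) • e.symm (T.swapVec ⟨j, by omega⟩) := by
          by_cases hle : T.seq j ≤ T.seq (j + 1)
          · rw [T.swapVec_of_le ⟨j, by omega⟩ hle]; simp
          · obtain ⟨T', h3, h4⟩ := T.exists_swapVec_of_not_le ⟨j, by omega⟩ hle
            have h5 := ih (by omega) T'
            rw [h3] at h5
            simp only [swapAt_left] at h5
            rw [h4]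
            exact h5
        rw [hact T j hj, map_add, map_smul, map_smul, h2, ih (by omega) T, eq_sub_iff_add_eq,
          show (q - 1) * jval q (ct (T.seq (j + 1))) + q = -(alpha q (ct (T.seq (j + 1)) -
            ct (T.seq j)) * (jval q (ct (T.seq j)) - jval q (ct (T.seq (j + 1))))) by
              rw [h0, neg_neg]]
        module
      have h6 := LinearMap.congr_fun (h.quad j hj) (b T)
      simp only [LinearMap.add_apply, Module.End.mul_apply, LinearMap.smul_apply,
        Module.End.one_apply] at h6
      rw [jm_succ, LinearMap.add_apply, LinearMap.smul_apply, Module.End.mul_apply,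
        Module.End.mul_apply, hX, map_sub, map_smul, map_smul, h6]
      have h7 : genAct ρ j (b T) = q⁻¹ • q • genAct ρ j (b T) := by
        rw [smul_smul, inv_mul_cancel₀ hq.ne_zero, one_smul]
      have h8 : jval q (ct (T.seq (j + 1))) • b T =
          q⁻¹ • q • jval q (ct (T.seq (j + 1))) • b T := by
        rw [smul_smul, inv_mul_cancel₀ hq.ne_zero, one_smul]
      rw [h8]
      nth_rewrite 1 [h7]
      module
  exact ⟨b, fun T j hj => key j hj T⟩

variable {lh lv : ℕ} (hlh : 1 ≤ lh) (hlv : 1 ≤ lv) (hq : QGeneric q) (hn : lh * lv ≤ n)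
include hlh hlv hq hn

theorem opQ_eq_zero_of_not_le (hd : HasDiagram ρ μ) (hle : ¬ rect lh lv ≤ μ) :
    ρ (opQ n q lh lv 1) = 0 := by
  obtain ⟨b, hb⟩ := exists_basis_of_hasDiagram hq hd
  refine b.ext fun T => opQ_apply_of_ne hlh hlv hn (T.isStd.mono hn) (hb T) fun him => hle ?_
  intro x hx
  have h1 : x ∈ T.seq '' Set.Iio (lh * lv) := him ▸ hx
  obtain ⟨a, ha, rfl⟩ := h1
  have h2 : T.seq a ∈ (μ.cells : Set (ℕ × ℕ)) :=
    T.image_seq ▸ ⟨a, lt_of_lt_of_le ha hn, rfl⟩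
  exact h2

theorem opQ_ne_zero_of_le (hd : HasDiagram ρ μ) (hle : rect lh lv ≤ μ) :
    ∃ v, ρ (opQ n q lh lv 1) v ≠ 0 := by
  classical
  obtain ⟨b, hb⟩ := exists_basis_of_hasDiagram hq hd
  have himage : ∀ (E : Finset (ℕ × ℕ)) (T : ℕ → ℕ × ℕ), IsStd E.card T →
      (∀ a < E.card, T a ∈ E) → T '' Set.Iio E.card = E := by
    intro E T hT hTE
    have : (Finset.range E.card).image T = E := by
      refine Finset.eq_of_subset_of_card_le (fun x hx => ?_) ?_
      · obtain ⟨j, hj, rfl⟩ := Finset.mem_image.mp hx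
        exact hTE j (Finset.mem_range.mp hj)
      · rw [Finset.card_image_of_injOn fun a ha b hb hab =>
          hT.inj a (by simpa using ha) b (by simpa using hb) hab, Finset.card_range]
    conv_rhs => rw [← this]
    simp
  -- Fill the rectangle starting from the empty tableau, then extend to all of `μ`.
  obtain ⟨T₁, h1, h2, -⟩ := IsStd.exists_extension (rect lh lv).isLowerSet _ 0 (fun _ => 0)
    ⟨fun a ha => by omega, fun b hb => by omega⟩ (fun a ha => by omega) (zero_add _)
  have hcard : μ.cells.card = n := hd.1
  obtain ⟨T₂, h3, h4, h5⟩ := IsStd.exists_extension μ.isLowerSet (μ.cells.card -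
    (rect lh lv).cells.card) (rect lh lv).cells.card T₁ h1 (fun a ha => hle (h2 a ha))
    (by have := Finset.card_le_card hle; omega)
  have him := himage _ _ h3 h4
  have him1 := himage _ _ h1 h2
  rw [hcard] at h3 him
  rw [card_rect] at h5 him1
  set T := StandardTableau.ofIsStd h3 him
  refine ⟨b T, ?_⟩
  rw [opQ_apply_of_eq hlh hlv hq hn (T.isStd.mono hn) (hb T)]
  · exact b.ne_zero T
  · rw [← him1]
    refine Set.image_congr fun a ha => ?_
    have ha : a < lh * lv := ha
    rw [StandardTableau.seq_ofIsStd _ _ (by omega), h5 a ha]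

end Diagram

theorem opQ_eq_one_of_rect {q : ℂ} (hq : QGeneric q) {lh lv : ℕ} (hlh : 1 ≤ lh) (hlv : 1 ≤ lv)
    {V : Type*} [AddCommGroup V] [Module ℂ V] {ρ : Hecke (lh * lv) q →ₐ[ℂ] Module.End ℂ V}
    (hd : HasDiagram ρ (rect lh lv)) : ρ (opQ (lh * lv) q lh lv 1) = 1 := by
  obtain ⟨b, hb⟩ := exists_basis_of_hasDiagram hq hd
  exact b.ext fun T => opQ_apply_of_eq hlh hlv hq le_rfl T.isStd (hb T) T.image_seq

/-! ### Translates of `Q` are conjugate -/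

section Conjugation

variable {n : ℕ} {q : ℂ}

/-- The product `g_1 g_2 ⋯ g_m`. -/
def cyc (n : ℕ) (q : ℂ) : ℕ → Hecke n q
  | 0 => 1
  | m + 1 => cyc n q m * gen n q (m + 1)

theorem commute_gen_cyc {m k : ℕ} (hk : m + 2 ≤ k) (hkn : k < n) :
    Commute (gen n q k) (cyc n q m) := by
  induction m with
  | zero => exact Commute.one_right _
  | succ m ih =>
    have h1 := (heckeRelations_gen n q).comm m (k - 1) (by omega) (by omega)
    rw [show k - 1 + 1 = k by omega] at h1
    exact (ih (by omega)).mul_right h1.symm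

/-- In `g_1 ⋯ g_m` only the factors `g_k g_{k+1}` interact with `g_k`, by one braid move. With `m =
n - 1`, conjugation shifts all indices in a Murphy operator and so takes `i` to `i + 1`. -/
theorem cyc_mul_gen {m k : ℕ} (hk : 1 ≤ k) (hkm : k + 1 ≤ m) (hm : m < n) :
    cyc n q m * gen n q k = gen n q (k + 1) * cyc n q m := by
  induction m with
  | zero => omega
  | succ m ih =>
    rcases hkm.eq_or_lt with h0 | h0
    · obtain ⟨l, rfl⟩ : ∃ l, k = l + 1 := ⟨k - 1, by omega⟩
      obtain rfl : m = l + 1 := by omega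
      have hb := (heckeRelations_gen n q).braid l hm
      have hc := (commute_gen_cyc (q := q) (m := l) (k := l + 2) le_rfl hm).eq
      rw [cyc, cyc, mul_assoc, mul_assoc, ← mul_assoc (gen n q (l + 1)), hb, ← mul_assoc,
        ← mul_assoc, ← hc]
      simp only [mul_assoc]
    · have h1 := (heckeRelations_gen n q).comm (k - 1) m (by omega) hm
      rw [show k - 1 + 1 = k by omega] at h1
      rw [cyc, mul_assoc, ← h1.eq, ← mul_assoc, ih (by omega) (by omega), mul_assoc]

theorem isUnit_gen (hq : q ≠ 0) {k : ℕ} (hk : 1 ≤ k) (hkn : k < n) : IsUnit (gen n q k) := by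
  have h := (heckeRelations_gen n q).quad (k - 1) (by omega)
  rw [show k - 1 + 1 = k by omega] at h
  refine ⟨⟨gen n q k, q⁻¹ • (gen n q k - (q - 1) • 1), ?_, ?_⟩, rfl⟩
  · rw [mul_smul_comm, mul_sub, h, mul_smul_comm, mul_one, add_sub_cancel_left, smul_smul,
      inv_mul_cancel₀ hq, one_smul]
  · rw [smul_mul_assoc, sub_mul, h, smul_mul_assoc, one_mul, add_sub_cancel_left, smul_smul,
      inv_mul_cancel₀ hq, one_smul]

theorem isUnit_cyc (hq : q ≠ 0) {m : ℕ} (hm : m < n) : IsUnit (cyc n q m) := by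
  induction m with
  | zero => exact isUnit_one
  | succ m ih => exact (ih (by omega)).mul (isUnit_gen hq (by omega) hm)

theorem cyc_mul_palindrome {m k : ℕ} (hk : k < m) (hm : m + 1 < n) :
    SemiconjBy (cyc n q (n - 1)) (palindrome n q m k) (palindrome n q (m + 1) k) := by
  have hg : ∀ k, 1 ≤ k → k + 1 < n →
      SemiconjBy (cyc n q (n - 1)) (gen n q k) (gen n q (k + 1)) := fun k h1 h2 =>
    cyc_mul_gen h1 (by omega) (by omega)
  induction k with
  | zero => exact hg m (by omega) hm
  | succ k ih =>
    have h1 := hg (m - (k + 1)) (by omega) (by omega)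
    rw [show m - (k + 1) + 1 = m + 1 - (k + 1) by omega] at h1
    exact (h1.mul_right (ih (by omega))).mul_right h1

theorem cyc_mul_murphy {i j : ℕ} (hi : 1 ≤ i) (hj : 1 ≤ j) (hij : i + j ≤ n) :
    SemiconjBy (cyc n q (n - 1)) (murphy n q i j) (murphy n q (i + 1) j) := by
  unfold murphy
  change _ * _ = _ * _
  rw [Finset.mul_sum, Finset.sum_mul]
  refine Finset.sum_congr rfl fun k hk => ?_
  have hk := Finset.mem_range.mp hk
  have := cyc_mul_palindrome (n := n) (q := q) (m := j + i - 2) (k := k) (by omega) (by omega)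
  rw [show j + i - 2 + 1 = j + (i + 1) - 2 by omega] at this
  rw [mul_smul_comm, this.eq, smul_mul_assoc]

theorem cyc_mul_murphyProd {i N : ℕ} (hi : 1 ≤ i) (hN : i + N ≤ n) (c : ℂ) :
    SemiconjBy (cyc n q (n - 1)) (murphyProd n q i N c) (murphyProd n q (i + 1) N c) := by
  unfold murphyProd
  have key : ∀ l : List ℕ, (∀ j ∈ l, 1 ≤ j ∧ i + j ≤ n) → SemiconjBy (cyc n q (n - 1))
      (l.map fun j => murphy n q i j - algebraMap ℂ (Hecke n q) c).prod
      (l.map fun j => murphy n q (i + 1) j - algebraMap ℂ (Hecke n q) c).prod := by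
    intro l
    induction l with
    | nil => intro _; exact SemiconjBy.one_right _
    | cons j l ih =>
      intro hl
      have h1 := hl j List.mem_cons_self
      rw [List.map_cons, List.prod_cons, List.map_cons, List.prod_cons]
      exact ((cyc_mul_murphy hi h1.1 h1.2).sub_right
        (Algebra.commutes c (cyc n q (n - 1))).symm).mul_right
          (ih fun a ha => hl a (List.mem_cons_of_mem _ ha))
  exact key _ fun j hj => by rw [List.mem_range'_1] at hj; omega

theorem cyc_mul_opQ {i lh lv : ℕ} (hi : 1 ≤ i) (hN : i + lh * lv ≤ n) :
    SemiconjBy (cyc n q (n - 1)) (opQ n q lh lv i) (opQ n q lh lv (i + 1)) := by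
  have hs : ∀ (r : ℂ) {x y : Hecke n q}, SemiconjBy (cyc n q (n - 1)) x y →
      SemiconjBy (cyc n q (n - 1)) (r • x) (r • y) := fun r x y hxy => by
    rw [SemiconjBy, mul_smul_comm, hxy.eq, smul_mul_assoc]
  exact (hs _ (cyc_mul_murphyProd hi hN _)).mul_right (hs _ (cyc_mul_murphyProd hi hN _))

/-- If the first translate of `Q` vanishes in a quotient, so do all translates. -/
theorem map_opQ_eq_zero (hq : q ≠ 0) {lh lv : ℕ} {B : Type*} [Ring B] [Algebra ℂ B]
    (π : Hecke n q →ₐ[ℂ] B) (h1 : π (opQ n q lh lv 1) = 0) {i : ℕ}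
    (hi : i ∈ Finset.Icc 1 (n + 1 - lh * lv)) : π (opQ n q lh lv i) = 0 := by
  rw [Finset.mem_Icc] at hi
  obtain ⟨hi1, hi2⟩ := hi
  induction i, hi1 using Nat.le_induction with
  | base => exact h1
  | succ i hi ih =>
    have h2 := congrArg π (cyc_mul_opQ (n := n) (q := q) (lh := lh) (lv := lv) hi (by omega)).eq
    rw [map_mul, map_mul, ih (by omega), mul_zero] at h2
    have hu := (isUnit_cyc (n := n) (q := q) hq (m := n - 1) (by omega)).map π
    exact hu.mul_left_eq_zero.mp h2.symm

end Conjugation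

/-! ### Simple left ideals in quotient algebras -/

section Quotient

variable {n : ℕ} {q : ℂ} {B : Type} [Ring B] [Algebra ℂ B] (π : Hecke n q →ₐ[ℂ] B)

theorem hecke_induction {P : Hecke n q → Prop} (hc : ∀ r, P (algebraMap ℂ _ r))
    (hg : ∀ i : Fin (n - 1), P (gen n q (i + 1))) (hm : ∀ x y, P x → P y → P (x * y))
    (ha : ∀ x y, P x → P y → P (x + y)) (x : Hecke n q) : P x := by
  obtain ⟨a, rfl⟩ := RingQuot.mkAlgHom_surjective ℂ (HeckeRel n q) x
  induction a using FreeAlgebra.induction with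
  | grade0 r => rw [AlgHom.commutes]; exact hc r
  | grade1 i =>
    have := hg i
    rwa [gen_eq (by omega) (by omega)] at this
  | mul x y hx hy => rw [map_mul]; exact hm _ _ hx hy
  | add x y hx hy => rw [map_add]; exact ha _ _ hx hy

/-- A joint eigenvector of the Murphy operators in a quotient of the Hecke algebra that belongs to
a standard tableau of shape `μ` yields an irreducible representation with diagram `μ`. -/
theorem exists_simple_hasDiagram (hq : QGeneric q) (hπ : Function.Surjective π)
    {T₀ : ℕ → ℕ × ℕ} (hT₀ : IsStd n T₀) {μ : YoungDiagram}
    (hμ : T₀ '' Set.Iio n = (μ.cells : Set (ℕ × ℕ))) (hcard : μ.card = n)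
    {w₀ : B} (hw₀ : w₀ ≠ 0)
    (hw : w₀ ∈ wt q (genAct ((Algebra.lsmul ℂ ℂ B).comp π)) n fun i => ct (T₀ i)) :
    ∃ V : Submodule B B, IsSimpleModule B V ∧ HasDiagram (pullback π V) μ := by
  classical
  set ρ : Hecke n q →ₐ[ℂ] Module.End ℂ B := (Algebra.lsmul ℂ ℂ B).comp π with hρ
  have hrel := heckeRelations_genAct ρ
  obtain ⟨w, hwT⟩ := exists_seminormal_family hrel hq hT₀ hw₀ hw
  set b : StandardTableau n μ → B := fun T => w T.seq with hb
  have hbT : ∀ T : StandardTableau n μ, b T ∈ (wt q (genAct ρ) n fun i => ct (T.seq i)) ∧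
      b T ≠ 0 ∧ ∀ j, j + 1 < n → ¬ T.seq j ≤ T.seq (j + 1) →
        psi q (genAct ρ) j (ct (T.seq j)) (ct (T.seq (j + 1))) (b T) = w (swapAt T.seq j) :=
    fun T => hwT T.seq T.isStd (T.image_seq.trans hμ.symm)
  set S := Submodule.span ℂ (Set.range b) with hS
  have hdist : ∀ T T' : StandardTableau n μ, T ≠ T' →
      ∃ i ∈ Set.Iio n, jval q (ct (T.seq i)) ≠ jval q (ct (T'.seq i)) := by
    intro T T' hne
    by_contra hcon
    push Not at hcon
    refine hne (StandardTableau.seq_injective (funext fun i => ?_))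
    rcases Nat.lt_or_ge i n with hi | hi
    · exact T.isStd.eq_of_ct_eq T'.isStd (fun a ha => hq.jval_injective (hcon a ha)) i hi
    · rw [T.seq_of_ge hi, T'.seq_of_ge hi]
  have hsep : ∀ N : Submodule ℂ B, (∀ i ∈ Set.Iio n, ∀ v ∈ N, jm q (genAct ρ) i v ∈ N) →
      ∀ f : StandardTableau n μ →₀ ℂ, (f.sum fun T r => r • b T) ∈ N →
        ∀ T ∈ f.support, b T ∈ N := by
    intro N hN f hf T hT
    have := mem_of_sum_mem (jm q (genAct ρ)) (Set.Iio n) N hN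
      (fun (T : StandardTableau n μ) i => jval q (ct (T.seq i))) f.support (fun T => f T • b T)
      (fun T _ i hi => by rw [map_smul, (hbT T).1 i hi, smul_comm])
      (fun T _ T' _ hne => hdist T T' hne) hf T hT
    exact (N.smul_mem_iff (Finsupp.mem_support_iff.mp hT)).mp this
  have hli : LinearIndependent ℂ b := by
    rw [linearIndependent_iff]
    intro f hf
    by_contra hf0
    obtain ⟨T, hT⟩ := Finsupp.support_nonempty_iff.mpr hf0
    have := hsep ⊥ (fun i _ v hv => by rw [(Submodule.mem_bot ℂ).mp hv, map_zero]; exact zero_mem _)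
      f (by rw [Finsupp.linearCombination_apply] at hf; rw [hf]; exact zero_mem _) T hT
    exact (hbT T).2.1 ((Submodule.mem_bot ℂ).mp this)
  have hact : ∀ (T : StandardTableau n μ) (i : Fin (n - 1)), π (gen n q (i + 1)) * b T =
      T.diagCoeff q i • b T + (1 + T.diagCoeff q i) •
        Finsupp.linearCombination ℂ b (T.swapVec i) := by
    intro T i
    have hi : (i : ℕ) + 1 < n := by omega
    have hg : π (gen n q (i + 1)) * b T = genAct ρ i (b T) := rfl
    rw [hg, T.diagCoeff_eq]
    by_cases hle : T.seq i ≤ T.seq (i + 1)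
    · rw [T.swapVec_of_le i hle, s_apply_of_le hrel hq T.isStd hi hle (hbT T).1]
      simp
    · obtain ⟨T', h1, h2⟩ := T.exists_swapVec_of_not_le i hle
      have h3 := T.isStd.two_le_of_not_le hi hle
      rw [h2, Finsupp.linearCombination_single, one_smul, hb]
      simp only
      rw [h1, ← (hbT T).2.2 i hi hle]
      exact s_apply_eq hq (by omega) (by omega) _
  have hSmem : ∀ f, Finsupp.linearCombination ℂ b f ∈ S := fun f => by
    rw [hS, ← Finsupp.range_linearCombination]; exact ⟨f, rfl⟩
  have hstab : ∀ x : Hecke n q, ∀ v ∈ S, π x * v ∈ S := by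
    intro x
    induction x using hecke_induction with
    | hc r =>
      intro v hv
      rw [AlgHom.commutes, ← Algebra.smul_def]
      exact S.smul_mem r hv
    | hg i =>
      intro v hv
      have : S ≤ S.comap (genAct ρ i) := by
        rw [hS, Submodule.span_le]
        rintro _ ⟨T, rfl⟩
        have h1 : genAct ρ i (b T) = π (gen n q (i + 1)) * b T := rfl
        rw [SetLike.mem_coe, Submodule.mem_comap, h1, hact]
        exact add_mem (Submodule.smul_mem _ _ (Submodule.subset_span ⟨T, rfl⟩))
          (Submodule.smul_mem _ _ (hSmem _))
      exact this hv
    | hm x y hx hy =>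
      intro v hv
      rw [map_mul, mul_assoc]
      exact hx _ (hy _ hv)
    | ha x y hx hy =>
      intro v hv
      rw [map_add, add_mul]
      exact add_mem (hx _ hv) (hy _ hv)
  -- Stability under the image of `π` makes the span a left ideal because `π` is surjective.
  let V : Submodule B B :=
    { carrier := S
      add_mem' := fun ha hb => S.add_mem ha hb
      zero_mem' := S.zero_mem
      smul_mem' := fun x v hv => by
        obtain ⟨y, rfl⟩ := hπ x
        exact hstab y v hv }
  have hVS : ∀ v, v ∈ V ↔ v ∈ S := fun v => Iff.rfl
  have hbV : ∀ T, b T ∈ V := fun T => Submodule.subset_span ⟨T, rfl⟩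
  refine ⟨V, ?_, hcard, ?_⟩
  · have hne : Nontrivial V := by
      refine ⟨⟨⟨b (StandardTableau.ofIsStd hT₀ hμ), hbV _⟩, 0, fun e => ?_⟩⟩
      exact (hbT (StandardTableau.ofIsStd hT₀ hμ)).2.1 (congrArg Subtype.val e)
    rw [isSimpleModule_iff]
    refine ⟨fun N => or_iff_not_imp_left.mpr fun hN => ?_⟩
    obtain ⟨v, hvN, hv0⟩ := Submodule.exists_mem_ne_zero_of_ne_bot hN
    set N' : Submodule B B := N.map V.subtype with hN'
    have hv' : (v : B) ∈ N' := ⟨v, hvN, rfl⟩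
    have hgN : ∀ x : Hecke n q, ∀ u ∈ N'.restrictScalars ℂ, ρ x u ∈ N'.restrictScalars ℂ :=
      fun x u hu => N'.smul_mem (π x) hu
    have hjN : ∀ i ∈ Set.Iio n, ∀ u ∈ N'.restrictScalars ℂ,
        jm q (genAct ρ) i u ∈ N'.restrictScalars ℂ := by
      intro i _ u hu
      have : jm q (genAct ρ) i = ρ (jm q (fun j => gen n q (j + 1)) i) := (map_jm _ ρ i).symm
      rw [this]
      exact hgN _ u hu
    obtain ⟨f, hf⟩ := (Finsupp.mem_span_range_iff_exists_finsupp).mp ((hVS v).mp v.2)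
    have hf0 : f ≠ 0 := by
      rintro rfl
      rw [Finsupp.sum_zero_index] at hf
      exact hv0 (Subtype.ext hf.symm)
    obtain ⟨T₁, hT₁⟩ := Finsupp.support_nonempty_iff.mpr hf0
    have hT₁N := hsep (N'.restrictScalars ℂ) hjN f (by rw [hf]; exact hv') T₁ hT₁
    -- One basis vector lies in the submodule; intertwiners carry it to all others because the
    -- standard tableaux of a shape are connected.
    have hall : ∀ T, b T ∈ N'.restrictScalars ℂ := by
      intro T
      refine (IsStd.connected (m := n) (fun T => T '' Set.Iio n = T₀ '' Set.Iio n ∧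
        w T ∈ N'.restrictScalars ℂ) ?_ T₁.isStd T.isStd
        (T₁.image_seq.trans T.image_seq.symm)
        (fun i hi => by rw [T₁.seq_of_ge hi, T.seq_of_ge hi])
        ⟨T₁.image_seq.trans hμ.symm, hT₁N⟩).2
      rintro T j ⟨h1, h2⟩ hT hj hle
      refine ⟨by rw [image_swapAt T hj, h1], ?_⟩
      rw [← (hwT T hT h1).2.2 j hj hle, psi_apply]
      exact Submodule.smul_mem _ _ (Submodule.sub_mem _ (hgN _ _ h2) (Submodule.smul_mem _ _ h2))
    rw [eq_top_iff]
    intro u _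
    have hu : (u : B) ∈ N'.restrictScalars ℂ := by
      have : S ≤ N'.restrictScalars ℂ := by
        rw [hS, Submodule.span_le]
        rintro _ ⟨T, rfl⟩
        exact hall T
      exact this ((hVS u).mp u.2)
    obtain ⟨u', hu', hue⟩ := hu
    rwa [← Subtype.ext hue]
  · let e₁ : V ≃ₗ[ℂ] S :=
      { toFun := fun v => ⟨v.1, v.2⟩
        invFun := fun v => ⟨v.1, v.2⟩
        map_add' := fun _ _ => rfl
        map_smul' := fun _ _ => rfl
        left_inv := fun _ => rfl
        right_inv := fun _ => rfl }
    let e : V ≃ₗ[ℂ] (StandardTableau n μ →₀ ℂ) := e₁.trans (Module.Basis.span hli).repr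
    have he : ∀ f, ((e.symm f : V) : B) = Finsupp.linearCombination ℂ b f := by
      intro f
      have h1 : ((e.symm f : V) : B) = (((Module.Basis.span hli).repr.symm f : S) : B) := rfl
      rw [h1, Module.Basis.repr_symm_apply]
      have h2 := (Finsupp.apply_linearCombination ℂ S.subtype (Module.Basis.span hli) f)
      rw [Submodule.subtype_apply] at h2
      rw [h2]
      congr 2
      funext T
      exact congrArg Subtype.val (Module.Basis.span_apply hli T)
    refine ⟨e, fun i v => ?_⟩
    obtain ⟨f, rfl⟩ := e.symm.surjective v
    rw [LinearEquiv.apply_symm_apply, ← LinearEquiv.eq_symm_apply]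
    refine Subtype.ext ?_
    have h1 : ((pullback π V (gen n q (i + 1)) (e.symm f) : V) : B) =
        genAct ρ i ((e.symm f : V) : B) := rfl
    rw [h1, he, he]
    clear h1
    induction f using Finsupp.induction_linear with
    | zero => simp
    | add f g hf hg => simp only [map_add, hf, hg]
    | single T r =>
      have h2 : genAct ρ i (b T) = π (gen n q (i + 1)) * b T := rfl
      rw [Finsupp.linearCombination_single, map_smul, h2, hact, seminormal,
        Finsupp.linearCombination_single, map_smul, map_add, map_smul, map_smul,
        Finsupp.linearCombination_single, one_smul]

/-- In `B` under left multiplication, a joint eigenvector not killed by `Q` has a tableau that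
starts with the rectangle, so it generates an excluded simple left ideal. The joint eigenvectors
span `B`, hence `Q` kills `1`. -/
theorem map_opQ_one_eq_zero (hq : QGeneric q) (hπ : Function.Surjective π) {lh lv : ℕ}
    (hlh : 1 ≤ lh) (hlv : 1 ≤ lv) (hn : lh * lv ≤ n) (hex : ExcludesRect π lh lv) :
    π (opQ n q lh lv 1) = 0 := by
  classical
  set ρ : Hecke n q →ₐ[ℂ] Module.End ℂ B := (Algebra.lsmul ℂ ℂ B).comp π with hρ
  have hrel := heckeRelations_genAct ρ
  obtain ⟨hA, hB⟩ := weights_of_le hrel hq n le_rfl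
  have h0 : (⊤ : Submodule ℂ B) ≤ LinearMap.ker (ρ (opQ n q lh lv 1)) := by
    rw [← hA]
    refine iSup_le fun c w hw => ?_
    by_cases hw0 : w = 0
    · rw [hw0]; exact zero_mem _
    obtain ⟨T, hT, hTc⟩ := hB c w hw0 hw
    have hw' : w ∈ wt q (genAct ρ) n fun i => ct (T i) :=
      wt_congr (fun j hj => (hTc j hj).symm) hw
    refine opQ_apply_of_ne hlh hlv hn (hT.mono hn) hw' fun him => ?_
    let μ : YoungDiagram :=
      { cells := (Finset.range n).image T
        isLowerSet := by
          intro x y hyx hx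
          obtain ⟨b, hb, rfl⟩ := Finset.mem_image.mp (Finset.mem_coe.mp hx)
          have hb := Finset.mem_range.mp hb
          obtain ⟨a, ha, rfl⟩ := hT.lower b hb y hyx
          exact Finset.mem_coe.mpr (Finset.mem_image_of_mem _ (Finset.mem_range.mpr (by omega))) }
    have hμ : T '' Set.Iio n = (μ.cells : Set (ℕ × ℕ)) := by simp [μ]
    have hcard : μ.card = n := by
      change ((Finset.range n).image T).card = n
      rw [Finset.card_image_of_injOn fun a ha b hb hab =>
        hT.inj a (by simpa using ha) b (by simpa using hb) hab, Finset.card_range]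
    obtain ⟨V, hV, hd⟩ := exists_simple_hasDiagram π hq hπ hT hμ hcard hw0 hw'
    refine hex V μ hd fun x hx => ?_
    have hx' : x ∈ T '' Set.Iio (lh * lv) := him ▸ hx
    obtain ⟨a, ha, rfl⟩ := hx'
    have h1 : T a ∈ (μ.cells : Set (ℕ × ℕ)) := hμ ▸ ⟨a, lt_of_lt_of_le ha hn, rfl⟩
    exact h1
  have h2 : ρ (opQ n q lh lv 1) 1 = 0 := h0 (x := 1) trivial
  have h3 : ρ (opQ n q lh lv 1) 1 = π (opQ n q lh lv 1) * 1 := rfl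
  rwa [h3, mul_one] at h2

end Quotient

end HeckeRect

end

theorem mainTheorem3 (q : ℝ) (hq : 0 < q) (lh lv : ℕ) (hlh : 1 ≤ lh) (hlv : 1 ≤ lv) :
    -- on the irreducible representations of `H_{lh lv}(q)`, `Q` is the identity on the
    -- rectangle and zero on all other diagrams
    (∀ (V : Type) [AddCommGroup V] [Module ℂ V] [Module (HeckeRect.Hecke (lh * lv) (q : ℂ)) V]
        [IsScalarTower ℂ (HeckeRect.Hecke (lh * lv) (q : ℂ)) V]
        [IsSimpleModule (HeckeRect.Hecke (lh * lv) (q : ℂ)) V] (μ : YoungDiagram),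
        HeckeRect.HasDiagram
          (HeckeRect.pullback (AlgHom.id ℂ (HeckeRect.Hecke (lh * lv) (q : ℂ))) V) μ →
        (μ = HeckeRect.rect lh lv →
          ∀ v : V, HeckeRect.opQ (lh * lv) (q : ℂ) lh lv 1 • v = v) ∧
        (μ ≠ HeckeRect.rect lh lv →
          ∀ v : V, HeckeRect.opQ (lh * lv) (q : ℂ) lh lv 1 • v = 0)) ∧
    ∀ n : ℕ, lh * lv ≤ n →
      -- an irreducible representation of `H_n(q)` is annihilated by all translates of `Q`
      -- exactly if its diagram does not contain the rectangle, and `Q^{(1)}` alone detects this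
      (∀ (V : Type) [AddCommGroup V] [Module ℂ V] [Module (HeckeRect.Hecke n (q : ℂ)) V]
          [IsScalarTower ℂ (HeckeRect.Hecke n (q : ℂ)) V]
          [IsSimpleModule (HeckeRect.Hecke n (q : ℂ)) V] (μ : YoungDiagram),
          HeckeRect.HasDiagram
            (HeckeRect.pullback (AlgHom.id ℂ (HeckeRect.Hecke n (q : ℂ))) V) μ →
          (¬ HeckeRect.rect lh lv ≤ μ →
            ∀ i ∈ Finset.Icc 1 (n + 1 - lh * lv), ∀ v : V,
              HeckeRect.opQ n (q : ℂ) lh lv i • v = 0) ∧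
          (HeckeRect.rect lh lv ≤ μ →
            ∃ v : V, HeckeRect.opQ n (q : ℂ) lh lv 1 • v ≠ 0)) ∧
      -- for every quotient algebra of `H_n(q)`, the vanishing of all translates of `Q` is
      -- necessary and sufficient for the exclusion of the diagrams that contain the rectangle
      (∀ (B : Type) [Ring B] [Algebra ℂ B] (π : HeckeRect.Hecke n (q : ℂ) →ₐ[ℂ] B),
          Function.Surjective π →
          ((∀ i ∈ Finset.Icc 1 (n + 1 - lh * lv), π (HeckeRect.opQ n (q : ℂ) lh lv i) = 0) ↔
            HeckeRect.ExcludesRect π lh lv)) := by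
  have hg := HeckeRect.qGeneric_ofReal hq
  refine ⟨fun V _ _ _ _ _ μ hd => ⟨?_, fun hne v => ?_⟩, fun n hn => ⟨?_, ?_⟩⟩
  · rintro rfl v
    exact LinearMap.congr_fun (HeckeRect.opQ_eq_one_of_rect hg hlh hlv hd) v
  · refine LinearMap.congr_fun
      (HeckeRect.opQ_eq_zero_of_not_le hlh hlv hg le_rfl hd fun hle => hne ?_) v
    have hcard : μ.cells.card = lh * lv := hd.1
    refine YoungDiagram.ext (Finset.eq_of_subset_of_card_le hle ?_).symm
    rw [hcard, HeckeRect.card_rect]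
  · intro V _ _ _ _ _ μ hd
    refine ⟨fun hle i hi v => ?_, fun hle => HeckeRect.opQ_ne_zero_of_le hlh hlv hg hn hd hle⟩
    exact LinearMap.congr_fun (HeckeRect.map_opQ_eq_zero hg.ne_zero _
      (HeckeRect.opQ_eq_zero_of_not_le hlh hlv hg hn hd hle) hi) v
  · intro B _ _ π hπ
    refine ⟨fun h V _ _ _ _ _ μ hd hle => ?_, fun hex i hi =>
      HeckeRect.map_opQ_eq_zero hg.ne_zero π
        (HeckeRect.map_opQ_one_eq_zero π hg hπ hlh hlv hn hex) hi⟩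
    obtain ⟨v, hv⟩ := HeckeRect.opQ_ne_zero_of_le hlh hlv hg hn hd hle
    apply hv
    have h1 : HeckeRect.pullback π V (HeckeRect.opQ n (q : ℂ) lh lv 1) v =
        π (HeckeRect.opQ n (q : ℂ) lh lv 1) • v := rfl
    rw [h1, h 1 (Finset.mem_Icc.mpr ⟨le_rfl, by omega⟩), zero_smul]
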